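/- **Setting.** Let $\mathbb X\subseteq\mathbb R^n$ be a Borel set with the distance $\|x-x'\|=\|x-x'\|_1$, let $\mathbb U$ be a finite nonempty action set, $\mathcal T(\cdot\mid x,u)$ a stochastic kernel from $\mathbb X\times\mathbb U$ to $\mathbb X$, $c:\mathbb X\times\mathbb U\to\mathbb R$ a bounded cost, and $0<\beta<1$. Assume that there are $\alpha_c,\alpha_T>0$ with $$|c(x,u)-c(x',u)|\le\alpha_c\|x-x'\|_1,\qquad \|\mathcal T(\cdot\mid x,u)-\mathcal T(\cdot\mid x',u)\|_{TV}\le\alpha_T\|x-x'\|_1\qquad(x,x'\in\mathbb X,\ u\in\mathbb U),$$ where $\|\mu-\nu\|_{TV}$ is the total mass of the total variation of the signed measure $\mu-\nu$. Let $J^*_\beta(x_0)=\inf_\gamma E^\gamma_{x_0}\big[\sum_{t\ge0}\beta^tc(X_t,U_t)\big]$, the infimum being over all admissible policies $U_t=\gamma_t(X_0,\dots,X_t,U_0,\dots,U_{t-1})$ with measurable $\gamma_t$. Let $B_1,\dots,B_M$ be a measurable partition of $\mathbb X$, let $q(x)=y_i$ for $x\in B_i$ be the quantizer, where the symbols $y_1,\dots,y_M$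 are distinct and represent the bins, and put $B_{y_i}=B_i$. Let $\gamma^*(du\mid x)$ be a stationary (randomized) exploration policy whose state process has a unique invariant probability measure $\pi$, and assume $\pi(B_i)>0$ for all $i$. Let $\hat\pi_{y_i}=\pi(\,\cdot\cap B_i)/\pi(B_i)$ and $$C^*(y,u)=\int_{B_y} c(x,u)\,\hat\pi_y(dx),\qquad P^*(y'\mid y,u)=\int_{B_y}\mathcal T(B_{y'}\mid x,u)\,\hat\pi_y(dx).$$ Given a path $(X_t,U_t)_{t\ge0}$ and an arbitrary initial function $Q_0$, quantized Q-learning is the recursion $$Q_{t+1}(y,u)=(1-\alpha_t(y,u))\,Q_t(y,u)+\alpha_t(y,u)\Big(c(X_t,u)+\beta\min_{v}Q_t(q(X_{t+1}),v)\Big),$$ with $\alpha_t(y,u)=\big(1+\sum_{k=0}^t \mathbf 1\{q(X_k)=y,U_k=u\}\big)^{-1}$ if $(q(X_t),U_t)=(y,u)$, and $\alpha_t(y,u)=0$ otherwise. **Theorem.** There is a function $Q^*$ on $\{y_1,\dots,y_M\}\times\mathbb U$ with the following properties. 1. $Q^*$ is the optimal $Q$-function of the finite model $(C^*,P^*)$: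 it is the unique solution of $$Q^*(y,u)=C^*(y,u)+\beta\sum_{y'}P^*(y'\mid y,u)\min_vQ^*(y',v)\qquad\text{for all }(y,u).$$ 2. $Q^*$ is the limit of quantized Q-learning: suppose that $\gamma^*(\cdot\mid x)$ depends on $x$ only through $q(x)$, that the process is run under $\gamma^*$ from an initial law $\rho$ of $X_0$ such that every measurable set of full $\pi$-measure is almost surely entered by $(X_t)$ (as is the case if $\rho\ll\pi$, or for every $\rho$ if the state process is positive Harris recurrent), and that almost surely every pair $(y,u)$ is visited infinitely often by $(q(X_t),U_t)$. Then, for every $Q_0$, almost surely $Q_t(y,u)\to Q^*(y,u)$ for all $(y,u)$. 3. For every initial state $x_0\in\mathbb X$, $$\Big|J^*_\beta(x_0)-\min_vQ^*(q(x_0),v)\Big|\le\Big(\alpha_c+\frac{\beta\alpha_T\|c\|_\infty}{1-\beta}\Big)\,\sup_{\gamma_s\in\Gamma_s}\frac1{1-\beta}\sum_{i=1}^M\int_{B_i}\int_{B_i}\|x-x'\|_1\,\mu_\beta^{\gamma_s}(dx)\,\hat\pi_{y_i}(dx'),$$ where $\Gamma_s$ is the set of deterministic stationary policies $U_t=f(X_t)$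 with $f$ measurable, and $\mu_\beta^{\gamma_s}(A)=(1-\beta)\sum_{t\ge0}\beta^tP^{\gamma_s}_{x_0}(X_t\in A)$ is the normalized discounted occupation measure. The right-hand side may be $+\infty$. -/

import Mathlib

open MeasureTheory ProbabilityTheory Filter Topology
open scoped ENNReal

noncomputable section

namespace QuantizedMDP

/-- The `ℓ¹` distance on `ℝⁿ`. -/
def l1Dist {n : ℕ} (x y : Fin n → ℝ) : ℝ := ∑ k, |x k - y k|

/-- The total variation norm `‖μ - ν‖_TV`, i.e. the total mass of the total variation measure of
the signed measure `μ - ν` (equal to `2 * sup_A |μ A - ν A|` for probability measures). -/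
def tvNorm {S : Type*} [MeasurableSpace S] (μ ν : Measure S)
    [IsFiniteMeasure μ] [IsFiniteMeasure ν] : ℝ :=
  ((μ.toSignedMeasure - ν.toSignedMeasure).totalVariation Set.univ).toReal

section Model

variable {S U : Type*} [MeasurableSpace S] [MeasurableSpace U]

/-! ### Policies and the law of the controlled process -/

/-- A (possibly randomized) history-dependent policy: `init` gives the conditional law of `U₀`
given `X₀`, and `next t` the conditional law of `U_{t+1}` given `((X₀,U₀),…,(X_t,U_t))` and
`X_{t+1}`. -/
structure Policy (S U : Type*) [MeasurableSpace S] [MeasurableSpace U] where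
  init : Kernel S U
  next : (t : ℕ) → Kernel (((i : Finset.Iic t) → S × U) × S) U
  markov_init : IsMarkovKernel init
  markov_next : ∀ t, IsMarkovKernel (next t)

attribute [instance] Policy.markov_init Policy.markov_next

/-- An admissible policy: `U_t` is a measurable function of
`I_t = (X₀,…,X_t,U₀,…,U_{t-1})`. -/
structure AdmissiblePolicy (S U : Type*) [MeasurableSpace S] [MeasurableSpace U] where
  init : S → U
  next : (t : ℕ) → ((i : Finset.Iic t) → S × U) × S → U
  measurable_init : Measurable init
  measurable_next : ∀ t, Measurable (next t)

/-- An admissible policy as a policy with Dirac conditional laws. -/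
def AdmissiblePolicy.toPolicy (γ : AdmissiblePolicy S U) : Policy S U where
  init := Kernel.deterministic γ.init γ.measurable_init
  next t := Kernel.deterministic (γ.next t) (γ.measurable_next t)
  markov_init := inferInstance
  markov_next _ := inferInstance

/-- The stationary policy which draws `U_t` from `η(· | X_t)` at all times. -/
def stationaryPolicy (η : Kernel S U) [IsMarkovKernel η] : Policy S U where
  init := η
  next _ := η.comap Prod.snd measurable_snd
  markov_init := inferInstance
  markov_next _ := inferInstance

/-- The conditional law of `(X_{t+1},U_{t+1})` given `((X₀,U₀),…,(X_t,U_t))`: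
`X_{t+1}` is drawn from `T(· | X_t,U_t)` and then `U_{t+1}` by the policy. -/
def stepKernel (T : Kernel (S × U) S) (γ : Policy S U) (t : ℕ) :
    Kernel ((i : Finset.Iic t) → S × U) (S × U) :=
  (T.comap (fun h => h ⟨t, Finset.mem_Iic.2 le_rfl⟩) (measurable_pi_apply _)) ⊗ₖ γ.next t

instance (T : Kernel (S × U) S) [IsMarkovKernel T] (γ : Policy S U) (t : ℕ) :
    IsMarkovKernel (stepKernel T γ t) := by
  unfold stepKernel; infer_instance

/-- The law of the state-action process `((X_t,U_t))_{t ≥ 0}` when `X₀ ∼ ρ`, the transition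
kernel is `T` and the actions are generated by the policy `γ`. -/
def pathLaw (T : Kernel (S × U) S) [IsMarkovKernel T] (ρ : Measure S) (γ : Policy S U) :
    Measure (ℕ → S × U) :=
  Kernel.trajMeasure (X := fun _ => S × U) (ρ ⊗ₘ γ.init) (stepKernel T γ)

/-! ### The discounted cost criterion -/

/-- `J_β(x₀,γ) = E[∑ₜ βᵗ c(X_t,U_t)]`. -/
def discountedCost (T : Kernel (S × U) S) [IsMarkovKernel T] (c : S → U → ℝ) (β : ℝ)
    (x₀ : S) (γ : AdmissiblePolicy S U) : ℝ :=
  ∫ ω, ∑' t : ℕ, β ^ t * c (ω t).1 (ω t).2 ∂(pathLaw T (Measure.dirac x₀) γ.toPolicy)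

/-- The optimal value function `J*_β`, an infimum over all admissible policies. -/
def optimalCost (T : Kernel (S × U) S) [IsMarkovKernel T] (c : S → U → ℝ) (β : ℝ) (x₀ : S) : ℝ :=
  ⨅ γ : AdmissiblePolicy S U, discountedCost T c β x₀ γ

/-- `‖c‖_∞`. -/
def supNorm (c : S → U → ℝ) : ℝ := ⨆ p : S × U, |c p.1 p.2|

/-- The normalized discounted occupation measure
`μ_β(A) = (1 - β) ∑ₜ βᵗ P(X_t ∈ A)` of the state, from `x₀` under the policy `γ`. -/
def occupationMeasure (T : Kernel (S × U) S) [IsMarkovKernel T] (β : ℝ) (x₀ : S)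
    (γ : Policy S U) : Measure S :=
  Measure.sum fun t : ℕ =>
    ENNReal.ofReal ((1 - β) * β ^ t) •
      (pathLaw T (Measure.dirac x₀) γ).map (fun ω => (ω t).1)

/-! ### The finite model

The quantizer is given by its index map `q : S → Fin M`, the bins are `B_i = q ⁻¹' {i}`, and the
representative of the bin `B_i` is identified with its index `i`. -/

variable {M : ℕ}

/-- The bin `B_i`. -/
def bin (q : S → Fin M) (i : Fin M) : Set S := q ⁻¹' {i}

/-- `π` conditioned on the bin `B_i`. -/
def binMeasure (q : S → Fin M) (π : Measure S) (i : Fin M) : Measure S := cond π (bin q i)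

/-- `C*(y,u)`. -/
def finiteCost (c : S → U → ℝ) (q : S → Fin M) (π : Measure S) (y : Fin M) (u : U) : ℝ :=
  ∫ x, c x u ∂(binMeasure q π y)

/-- `P*(y' | y,u)`. -/
def finiteTransition (T : Kernel (S × U) S) (q : S → Fin M) (π : Measure S)
    (y' y : Fin M) (u : U) : ℝ :=
  ∫ x, (T (x, u)).real (bin q y') ∂(binMeasure q π y)

/-- `Q` solves the optimality equation of the finite model with weighting measure `π`, i.e. it is
the optimal `Q`-function of this model. -/
def IsFiniteModelQ (T : Kernel (S × U) S) (c : S → U → ℝ) (β : ℝ) (q : S → Fin M)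
    (π : Measure S) (Q : Fin M → U → ℝ) : Prop :=
  ∀ y u, Q y u =
    finiteCost c q π y u + β * ∑ y', finiteTransition T q π y' y u * ⨅ v, Q y' v

/-! ### Quantized Q-learning -/

open Classical in
/-- The step size `α_t(y,u)` along the state-action path `ω`. -/
def stepSize (q : S → Fin M) (ω : ℕ → S × U) (t : ℕ) (y : Fin M) (u : U) : ℝ :=
  if q (ω t).1 = y ∧ (ω t).2 = u then
    1 / (1 + (((Finset.range (t + 1)).filter
      (fun k => q (ω k).1 = y ∧ (ω k).2 = u)).card : ℝ))
  else 0

/-- The iterates of quantized Q-learning along the state-action path `ω`, started from `Q₀`. -/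
def qLearning (c : S → U → ℝ) (β : ℝ) (q : S → Fin M) (Q₀ : Fin M → U → ℝ)
    (ω : ℕ → S × U) : ℕ → Fin M → U → ℝ
  | 0 => Q₀
  | t + 1 => fun y u =>
      (1 - stepSize q ω t y u) * qLearning c β q Q₀ ω t y u
        + stepSize q ω t y u *
          (c (ω t).1 u + β * ⨅ v, qLearning c β q Q₀ ω t (q (ω (t + 1)).1) v)

/-- The transition kernel of the state process under the stationary policy `η`. -/
def stateKernel (T : Kernel (S × U) S) (η : Kernel S U) : Kernel S S :=
  T ∘ₖ (Kernel.id ×ₖ η)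

/-- The probability measure `π` is the unique invariant probability measure of `κ`. -/
def IsUniqueInvariant (κ : Kernel S S) (π : Measure S) : Prop :=
  IsProbabilityMeasure π ∧ κ.Invariant π ∧
    ∀ π' : Measure S, IsProbabilityMeasure π' → κ.Invariant π' → π' = π

end Model

end QuantizedMDP

end

/-! Write W(x) = min_v Q*(q(x), v), and let `qValue` with terminal function h be c(x,u) + β ∫ h
dT(x,u). The equation of the finite model says exactly that Q*(y,u) is the average over the bin y,
under π conditioned on it, of the `qValue` of W (`isFiniteModelQ_iff`). Averages and minima do not
expand the sup distance, so the right-hand side is a β-contraction in Q; this gives existence and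
uniqueness.

Convergence of the learning. The step sizes make Q_t(y,u) a plain average of Q_0(y,u) and of the
targets at the visits to (y,u) (`qLearning_eq_average`). With Q* in place of the iterate, each
target is a bounded function of two consecutive state-action pairs, and the law of large numbers
applies. As the policy is constant on the bins, the stationary law of the state seen at a visit to
(y,u) is π conditioned on the bin, so the averages tend to Q*(y,u). Reinstating the iterate costs at
most β times a weighted average of the past errors; hence the limsup of the error is at most β times
itself, and the error vanishes (`tendsto_zero_of_weighted_average`). The argument is pathwise once
the ergodic averages converge.

The law of large numbers combines Birkhoff's theorem, obtained from running maxima of Birkhoff sums,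
with the ergodicity of the stationary chain. For a shift invariant event, its probability g as a
function of the initial state is harmonic, so the invariant measure weighted by g is again
invariant, and uniqueness forces g to be constant almost everywhere. Convergence of averages is
itself a shift invariant event, which has probability one from almost every initial state; for
another initial law it suffices that such a state is entered.

Error bound. The optimal cost is the bounded solution V of the optimality equation
(`optimalCost_eq_of_bellman`). With D = |V - W|, the Lipschitz hypotheses give D(x) ≤ κ r(x) + β
max_u ∫ D dT(x,u), where r is the average distance from x to its bin and κ = α_c + β α_T ‖c‖/(1-β).
Iterating this along a measurable maximizer f produces the discounted sum of κ r along the chain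
controlled by f, that is, an integral against its occupation measure. The selector f pursues the
error and not the cost, which is why a supremum over stationary policies appears. -/

namespace QuantizedMDP

/-! ### The pointwise ergodic theorem -/

section Birkhoff

variable {Ω : Type*} {θ : Ω → Ω} {f : Ω → ℝ}

/-- The running maximum `max (0, f, f + f ∘ θ, …)` of the first `n` Birkhoff sums. -/
def maxBirkhoffSum (θ : Ω → Ω) (f : Ω → ℝ) : ℕ → Ω → ℝ
  | 0 => fun _ => 0
  | n + 1 => fun ω => max 0 (f ω + maxBirkhoffSum θ f n (θ ω))

lemma maxBirkhoffSum_nonneg (n : ℕ) (ω : Ω) : 0 ≤ maxBirkhoffSum θ f n ω := by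
  cases n with
  | zero => exact le_rfl
  | succ n => exact le_max_left _ _

lemma maxBirkhoffSum_le_succ (n : ℕ) (ω : Ω) :
    maxBirkhoffSum θ f n ω ≤ maxBirkhoffSum θ f (n + 1) ω := by
  induction n generalizing ω with
  | zero => exact maxBirkhoffSum_nonneg 1 ω
  | succ n ih => exact max_le_max le_rfl (add_le_add le_rfl (ih (θ ω)))

lemma monotone_maxBirkhoffSum (ω : Ω) : Monotone fun n => maxBirkhoffSum θ f n ω :=
  monotone_nat_of_le_succ fun n => maxBirkhoffSum_le_succ n ω

lemma birkhoffSum_le_maxBirkhoffSum (n : ℕ) (ω : Ω) :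
    birkhoffSum θ f n ω ≤ maxBirkhoffSum θ f n ω := by
  induction n generalizing ω with
  | zero => simp [maxBirkhoffSum]
  | succ n ih =>
    rw [birkhoffSum_succ']
    exact (add_le_add le_rfl (ih (θ ω))).trans (le_max_right _ _)

/-- By the recursion, passing from θω to ω changes the maxima by a bounded amount. This makes the
event of bounded maxima invariant, so that ergodicity applies to it. -/
lemma bddAbove_maxBirkhoffSum_comp_iff (ω : Ω) :
    BddAbove (Set.range fun n => maxBirkhoffSum θ f n (θ ω)) ↔
      BddAbove (Set.range fun n => maxBirkhoffSum θ f n ω) := by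
  constructor
  · rintro ⟨K, hK⟩
    refine ⟨max 0 (f ω + K), ?_⟩
    rintro _ ⟨n, rfl⟩
    exact (maxBirkhoffSum_le_succ n ω).trans
      (max_le_max le_rfl (add_le_add le_rfl (hK ⟨n, rfl⟩)))
  · rintro ⟨K, hK⟩
    refine ⟨K - f ω, ?_⟩
    rintro _ ⟨n, rfl⟩
    have h1 : maxBirkhoffSum θ f (n + 1) ω ≤ K := hK ⟨n + 1, rfl⟩
    have h2 : f ω + maxBirkhoffSum θ f n (θ ω) ≤ maxBirkhoffSum θ f (n + 1) ω := le_max_right _ _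
    simp only
    linarith

variable [MeasurableSpace Ω] {μ : Measure Ω}

lemma measurable_maxBirkhoffSum (hθ : Measurable θ) (hf : Measurable f) (n : ℕ) :
    Measurable (maxBirkhoffSum θ f n) := by
  induction n with
  | zero => exact measurable_const
  | succ n ih => exact measurable_const.max (hf.add (ih.comp hθ))

lemma integrable_maxBirkhoffSum [IsFiniteMeasure μ] (hθ : MeasurePreserving θ μ μ)
    (hf : Integrable f μ) (n : ℕ) : Integrable (maxBirkhoffSum θ f n) μ := by
  induction n with
  | zero => exact integrable_zero _ _ _
  | succ n ih =>
    exact (integrable_zero Ω ℝ μ).sup (hf.add (hθ.integrable_comp_of_integrable ih))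

/-- Birkhoff sums of a function with negative mean are almost surely bounded above. -/
theorem ae_bddAbove_maxBirkhoffSum [IsProbabilityMeasure μ] (hθ : Ergodic θ μ)
    (hf : Measurable f) (hfi : Integrable f μ) (hneg : ∫ ω, f ω ∂μ < 0) :
    ∀ᵐ ω ∂μ, BddAbove (Set.range fun n => maxBirkhoffSum θ f n ω) := by
  have hms : MeasurableSet {ω | BddAbove (Set.range fun n => maxBirkhoffSum θ f n ω)} :=
    measurableSet_bddAbove_range fun n => measurable_maxBirkhoffSum hθ.measurable hf n
  -- The invariant event of boundedness has measure zero or one; suppose, for a contradiction, that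
  -- the maxima are almost surely unbounded.
  refine (hθ.toPreErgodic.ae_mem_or_ae_notMem hms
    (Set.ext fun ω => bddAbove_maxBirkhoffSum_comp_iff ω)).resolve_right fun hE => ?_
  have hlim : ∀ᵐ ω ∂μ, Tendsto
      (fun n => maxBirkhoffSum θ f (n + 1) ω - maxBirkhoffSum θ f n (θ ω)) atTop (𝓝 (f ω)) := by
    filter_upwards [hE] with ω hω
    have htop : Tendsto (fun n => maxBirkhoffSum θ f n (θ ω)) atTop atTop :=
      (tendsto_atTop_of_monotone (monotone_maxBirkhoffSum (θ ω))).resolve_right fun ⟨l, hl⟩ =>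
        hω ((bddAbove_maxBirkhoffSum_comp_iff ω).1 hl.bddAbove_range)
    -- Once the maximum at θω exceeds -f(ω), the cut-off at 0 is inactive and the difference equals
    -- f(ω) exactly.
    refine tendsto_const_nhds.congr' ?_
    filter_upwards [htop.eventually_ge_atTop (-f ω)] with n hn
    simp only [maxBirkhoffSum]
    rw [max_eq_right (by linarith)]
    ring
  have hcomp : ∀ n, Integrable (fun ω => maxBirkhoffSum θ f n (θ ω)) μ := fun n =>
    hθ.toMeasurePreserving.integrable_comp_of_integrable
      (integrable_maxBirkhoffSum hθ.toMeasurePreserving hfi n)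
  have hint : ∀ n, Integrable
      (fun ω => maxBirkhoffSum θ f (n + 1) ω - maxBirkhoffSum θ f n (θ ω)) μ := fun n =>
    (integrable_maxBirkhoffSum hθ.toMeasurePreserving hfi (n + 1)).sub (hcomp n)
  -- Here max(0, f + m) - m = max(-m, f) with m ≥ 0, which is at most |f| in absolute value.
  have hdom := tendsto_integral_of_dominated_convergence (fun ω => |f ω|)
    (fun n => (hint n).aestronglyMeasurable) hfi.abs
    (fun n => Eventually.of_forall fun ω => by
      simp only [maxBirkhoffSum, Real.norm_eq_abs]
      have h0 := maxBirkhoffSum_nonneg (θ := θ) (f := f) n (θ ω)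
      rw [abs_le]
      rcases max_cases 0 (f ω + maxBirkhoffSum θ f n (θ ω)) with ⟨h, h'⟩ | ⟨h, h'⟩ <;>
        rw [h] <;> constructor <;> linarith [neg_abs_le (f ω), le_abs_self (f ω), abs_nonneg (f ω)])
    hlim
  -- As θ preserves μ, each integral is that of the increment of a monotone sequence, hence
  -- nonnegative; the limit, the integral of f, cannot be negative.
  refine absurd (ge_of_tendsto' hdom fun n => ?_) (not_le.2 hneg)
  rw [integral_sub (integrable_maxBirkhoffSum hθ.toMeasurePreserving hfi (n + 1)) (hcomp n),
    sub_nonneg]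
  have h1 : ∫ ω, maxBirkhoffSum θ f n (θ ω) ∂μ = ∫ ω, maxBirkhoffSum θ f n ω ∂μ := by
    conv_rhs => rw [← hθ.toMeasurePreserving.map_eq]
    exact (integral_map hθ.measurable.aemeasurable
      (measurable_maxBirkhoffSum hθ.measurable hf n).aestronglyMeasurable).symm
  rw [h1]
  exact integral_mono (integrable_maxBirkhoffSum hθ.toMeasurePreserving hfi n)
    (integrable_maxBirkhoffSum hθ.toMeasurePreserving hfi (n + 1))
    fun ω => maxBirkhoffSum_le_succ n ω

/-- For b strictly between the mean and a, the function f - b has negative mean. Its Birkhoff sums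
are bounded by some K, so the averages of f are at most b + K/n. -/
lemma ae_eventually_birkhoffAverage_lt [IsProbabilityMeasure μ] (hθ : Ergodic θ μ)
    (hf : Measurable f) (hfi : Integrable f μ) {a : ℝ} (ha : ∫ ω, f ω ∂μ < a) :
    ∀ᵐ ω ∂μ, ∀ᶠ n in atTop, birkhoffAverage ℝ θ f n ω < a := by
  obtain ⟨b, hb, hba⟩ := exists_between ha
  have hneg : ∫ ω, (f ω - b) ∂μ < 0 := by
    rw [integral_sub hfi (integrable_const _)]
    simpa using hb
  filter_upwards [ae_bddAbove_maxBirkhoffSum hθ (hf.sub_const b)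
    (hfi.sub (integrable_const b)) hneg] with ω ⟨K, hK⟩
  have hlim : Tendsto (fun n : ℕ => b + K / n) atTop (𝓝 (b + 0)) :=
    tendsto_const_nhds.add (tendsto_const_div_atTop_nhds_zero_nat K)
  rw [add_zero] at hlim
  filter_upwards [hlim.eventually_lt_const hba, eventually_gt_atTop 0] with n hn hn0
  refine lt_of_le_of_lt ?_ hn
  have h1 := (birkhoffSum_le_maxBirkhoffSum (θ := θ) (f := fun ω => f ω - b) n ω).trans
    (hK ⟨n, rfl⟩)
  have h2 : birkhoffSum θ (fun ω => f ω - b) n ω = birkhoffSum θ f n ω - n * b := by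
    simp [birkhoffSum, Finset.sum_sub_distrib]
  rw [h2] at h1
  have hn' : (0 : ℝ) < n := by exact_mod_cast hn0
  rw [birkhoffAverage, smul_eq_mul, inv_mul_le_iff₀ hn', mul_add, mul_div_cancel₀ _ hn'.ne']
  linarith

/-- The pointwise ergodic theorem for ergodic transformations of a probability space. -/
theorem ae_tendsto_birkhoffAverage [IsProbabilityMeasure μ] (hθ : Ergodic θ μ)
    (hf : Measurable f) (hfi : Integrable f μ) :
    ∀ᵐ ω ∂μ, Tendsto (fun n => birkhoffAverage ℝ θ f n ω) atTop (𝓝 (∫ ω, f ω ∂μ)) := by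
  have hup : ∀ᵐ ω ∂μ, ∀ k : ℕ, ∀ᶠ n in atTop,
      birkhoffAverage ℝ θ f n ω < ∫ ω, f ω ∂μ + 1 / ((k : ℝ) + 1) :=
    ae_all_iff.2 fun k => ae_eventually_birkhoffAverage_lt hθ hf hfi
      (lt_add_of_pos_right _ Nat.one_div_pos_of_nat)
  have hlow : ∀ᵐ ω ∂μ, ∀ k : ℕ, ∀ᶠ n in atTop,
      birkhoffAverage ℝ θ (-f) n ω < -∫ ω, f ω ∂μ + 1 / ((k : ℝ) + 1) :=
    ae_all_iff.2 fun k => ae_eventually_birkhoffAverage_lt hθ hf.neg hfi.neg (by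
      have h : ∫ ω, (-f) ω ∂μ = -∫ ω, f ω ∂μ := integral_neg f
      rw [h]
      exact lt_add_of_pos_right _ Nat.one_div_pos_of_nat)
  filter_upwards [hup, hlow] with ω h1 h2
  rw [Metric.tendsto_nhds]
  intro ε hε
  obtain ⟨k, hk⟩ := exists_nat_one_div_lt hε
  filter_upwards [h1 k, h2 k] with n hn1 hn2
  have h3 : birkhoffAverage ℝ θ (-f) n ω = -birkhoffAverage ℝ θ f n ω :=
    congrFun (congrFun (birkhoffAverage_neg (R := ℝ) (f := θ) (g := f)) n) ω
  rw [h3] at hn2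
  rw [Real.dist_eq, abs_lt]
  constructor <;> linarith

end Birkhoff

/-! ### Laws of homogeneous Markov chains -/

section Chain

variable {Z : Type*} [MeasurableSpace Z]

/-- The history of a path up to time `n`. -/
abbrev history (n : ℕ) (ω : ℕ → Z) : (i : Finset.Iic n) → Z :=
  Preorder.frestrictLe (π := fun _ : ℕ => Z) n ω

/-- The shift of a path by `t`. -/
def shift (t : ℕ) (ω : ℕ → Z) : ℕ → Z := fun n => ω (t + n)

omit [MeasurableSpace Z] in
lemma iterate_shift_one (n : ℕ) : (shift 1 : (ℕ → Z) → ℕ → Z)^[n] = shift n := by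
  induction n with
  | zero => funext ω k; simp [shift]
  | succ n ih =>
    rw [Function.iterate_succ', ih]
    funext ω k
    simp only [shift, Function.comp_apply]
    congr 1
    omega

omit [MeasurableSpace Z] in
lemma preimage_shift_eq_self {C : Set (ℕ → Z)} (hC : shift 1 ⁻¹' C = C) (t : ℕ) :
    shift t ⁻¹' C = C := by
  rw [← iterate_shift_one]
  exact Function.IsFixedPt.preimage_iterate hC t

lemma measurable_shift (t : ℕ) : Measurable (shift t : (ℕ → Z) → ℕ → Z) :=
  measurable_pi_lambda _ fun _ => measurable_pi_apply _

lemma measurable_history (n : ℕ) : Measurable (history n : (ℕ → Z) → _) :=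
  Preorder.measurable_frestrictLe n

/-- `Q` is the law of a Markov chain with transition kernel `K`, with arbitrary initial law. -/
def IsMarkovLaw (K : Kernel Z Z) (Q : Measure (ℕ → Z)) : Prop :=
  ∀ n (A : Set ((i : Finset.Iic n) → Z)), MeasurableSet A → ∀ B, MeasurableSet B →
    Q (history n ⁻¹' A ∩ {ω | ω (n + 1) ∈ B}) = ∫⁻ ω in history n ⁻¹' A, K (ω n) B ∂Q

/-- Finite measures on the path space with the same finite-dimensional marginals agree. -/
lemma ext_of_map_history {Q Q' : Measure (ℕ → Z)} [IsFiniteMeasure Q] [IsFiniteMeasure Q']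
    (h : ∀ n, Q.map (history n) = Q'.map (history n)) : Q = Q' := by
  refine IsProjectiveLimit.unique (P := fun I => Q.map I.restrict) (fun I => rfl) fun I => ?_
  -- Every finite set of times lies in an initial segment, so the laws of the histories determine
  -- all finite-dimensional marginals.
  have hI := I.subset_Iic_sup_id
  have h1 : (I.restrict : (ℕ → Z) → _) =
      Finset.restrict₂ (π := fun _ => Z) hI ∘ history (I.sup id) := rfl
  have hm : Measurable (Finset.restrict₂ (π := fun _ : ℕ => Z) hI) :=
    Finset.measurable_restrict₂ _
  change Q'.map I.restrict = Q.map I.restrict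
  rw [h1, ← Measure.map_map hm (measurable_history _), ← Measure.map_map hm (measurable_history _),
    h]

omit [MeasurableSpace Z] in
lemma history_zero (ω : ℕ → Z) : history 0 ω = fun _ => ω 0 := by
  funext i
  obtain ⟨i, hi⟩ := i
  obtain rfl : i = 0 := by simpa using hi
  rfl

/-- Extension of a history by one state. -/
def snocHistory (n : ℕ) (p : ((i : Finset.Iic n) → Z) × Z) : (i : Finset.Iic (n + 1)) → Z :=
  fun i => if h : (i : ℕ) ≤ n then p.1 ⟨i, Finset.mem_Iic.2 h⟩ else p.2

lemma measurable_snocHistory (n : ℕ) : Measurable (snocHistory (Z := Z) n) := by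
  refine measurable_pi_lambda _ fun i => ?_
  unfold snocHistory
  split_ifs with h
  · exact (measurable_pi_apply _).comp measurable_fst
  · exact measurable_snd

omit [MeasurableSpace Z] in
lemma snocHistory_history (n : ℕ) (ω : ℕ → Z) :
    snocHistory n (history n ω, ω (n + 1)) = history (n + 1) ω := by
  funext i
  obtain ⟨i, hi⟩ := i
  have hi' : i ≤ n + 1 := Finset.mem_Iic.1 hi
  simp only [snocHistory]
  split_ifs with h
  · rfl
  · obtain rfl : i = n + 1 := by omega
    rfl

/-- A Markov law is determined by its transition kernel and its initial law. -/
theorem IsMarkovLaw.unique {K : Kernel Z Z} {Q Q' : Measure (ℕ → Z)}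
    [IsFiniteMeasure Q] [IsFiniteMeasure Q'] (hQ : IsMarkovLaw K Q) (hQ' : IsMarkovLaw K Q')
    (h0 : Q.map (fun ω => ω 0) = Q'.map (fun ω => ω 0)) : Q = Q' := by
  refine ext_of_map_history fun n => ?_
  induction n with
  | zero =>
    have h1 : (history 0 : (ℕ → Z) → _) = (fun z _ => z) ∘ fun ω => ω 0 := by
      funext ω; exact history_zero ω
    have hm : Measurable (fun (z : Z) (_ : Finset.Iic 0) => z) :=
      measurable_pi_lambda _ fun _ => measurable_id
    rw [h1, ← Measure.map_map hm (measurable_pi_apply 0),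
      ← Measure.map_map hm (measurable_pi_apply 0), h0]
  | succ n ih =>
    have h1 : (history (n + 1) : (ℕ → Z) → _) =
        snocHistory n ∘ fun ω => (history n ω, ω (n + 1)) := by
      funext ω; exact (snocHistory_history n ω).symm
    have hm : Measurable fun ω : ℕ → Z => (history n ω, ω (n + 1)) :=
      (measurable_history n).prodMk (measurable_pi_apply _)
    rw [h1, ← Measure.map_map (measurable_snocHistory n) hm,
      ← Measure.map_map (measurable_snocHistory n) hm]
    congr 1
    refine Measure.ext_prod fun {A B} hA hB => ?_
    have key : ∀ R : Measure (ℕ → Z), IsMarkovLaw K R →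
        R.map (fun ω : ℕ → Z => (history n ω, ω (n + 1))) (A ×ˢ B) =
          ∫⁻ h in A, K (h ⟨n, Finset.mem_Iic.2 le_rfl⟩) B ∂(R.map (history n)) := fun R hR => by
      have hg : Measurable fun h : (i : Finset.Iic n) → Z =>
          K (h ⟨n, Finset.mem_Iic.2 le_rfl⟩) B :=
        (K.measurable_coe hB).comp (measurable_pi_apply _)
      rw [Measure.map_apply hm (hA.prod hB), setLIntegral_map hA hg (measurable_history n)]
      exact hR n A hA B hB
    rw [key Q hQ, key Q' hQ', ih]

/-- The law of the chain after time `t`, on an event which depends on the history up to time `t`,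
is again Markov. -/
theorem IsMarkovLaw.restrict_map_shift {K : Kernel Z Z} {Q : Measure (ℕ → Z)}
    (hQ : IsMarkovLaw K Q) (t : ℕ) {F : Set ((i : Finset.Iic t) → Z)} (hF : MeasurableSet F) :
    IsMarkovLaw K ((Q.restrict (history t ⁻¹' F)).map (shift t)) := by
  intro n A hA B hB
  -- A history up to time t + n contains both the first n + 1 states of the shifted path (σ) and the
  -- original history up to t (τ). The Markov property at time t + n therefore handles both
  -- conditions at once.
  let σ : ((i : Finset.Iic (t + n)) → Z) → (i : Finset.Iic n) → Z := fun h i =>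
    h ⟨t + i, Finset.mem_Iic.2 (Nat.add_le_add_left (Finset.mem_Iic.1 i.2) t)⟩
  have hσ : Measurable σ := measurable_pi_lambda _ fun i => measurable_pi_apply _
  let τ : ((i : Finset.Iic (t + n)) → Z) → (i : Finset.Iic t) → Z :=
    Preorder.frestrictLe₂ (π := fun _ => Z) (Nat.le_add_right t n)
  have hτ : Measurable τ := Preorder.measurable_frestrictLe₂ _
  have hmain := hQ (t + n) (τ ⁻¹' F ∩ σ ⁻¹' A) ((hτ hF).inter (hσ hA)) B hB
  have hset : history (t + n) ⁻¹' (τ ⁻¹' F ∩ σ ⁻¹' A) =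
      shift t ⁻¹' (history n ⁻¹' A) ∩ history t ⁻¹' F := by
    ext ω
    exact and_comm
  have hAm : MeasurableSet (history n ⁻¹' A) := measurable_history n hA
  have hBm : MeasurableSet {ω : ℕ → Z | ω (n + 1) ∈ B} := measurable_pi_apply (n + 1) hB
  have hg : Measurable fun ω : ℕ → Z => K (ω n) B :=
    (K.measurable_coe hB).comp (measurable_pi_apply n)
  rw [Measure.map_apply (measurable_shift t) (hAm.inter hBm),
    Measure.restrict_apply (measurable_shift t (hAm.inter hBm)),
    setLIntegral_map hAm hg (measurable_shift t),
    Measure.restrict_restrict (measurable_shift t hAm), ← hset]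
  refine Eq.trans ?_ hmain
  rw [hset]
  congr 1
  ext ω
  simp only [shift, Set.mem_inter_iff, Set.mem_preimage, Set.mem_ofPred_eq, add_assoc]
  tauto

/-- The law of the chain with transition kernel `K`, as a kernel in the initial state. -/
noncomputable def chainLaw (K : Kernel Z Z) [IsMarkovKernel K] : Kernel Z (ℕ → Z) :=
  (Kernel.traj (X := fun _ => Z)
    (fun n => K.comap (fun h => h ⟨n, Finset.mem_Iic.2 le_rfl⟩) (measurable_pi_apply _)) 0).comap
    (MeasurableEquiv.piUnique fun _ : Finset.Iic 0 => Z).symm (MeasurableEquiv.measurable _)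

instance (K : Kernel Z Z) [IsMarkovKernel K] : IsMarkovKernel (chainLaw K) := by
  unfold chainLaw; infer_instance

/-- The law of a trajectory is Markov if its transition probabilities depend only on the last
state. -/
lemma isMarkovLaw_trajMeasure (K : Kernel Z Z) (κ : (n : ℕ) → Kernel ((i : Finset.Iic n) → Z) Z)
    [∀ n, IsMarkovKernel (κ n)]
    (hκ : ∀ n h, κ n h = K (h ⟨n, Finset.mem_Iic.2 le_rfl⟩)) (μ : Measure Z)
    [IsProbabilityMeasure μ] :
    IsMarkovLaw K (Kernel.trajMeasure (X := fun _ => Z) μ κ) := by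
  intro n A hA B hB
  have h := Kernel.map_frestrictLe_trajMeasure_compProd_eq_map_trajMeasure
    (X := fun _ => Z) (μ₀ := μ) (κ := κ) (a := n)
  have h1 := congrArg (fun m => m (A ×ˢ B)) h
  have hm : Measurable fun ω : ℕ → Z => (history n ω, ω (n + 1)) :=
    (measurable_history n).prodMk (measurable_pi_apply _)
  rw [Measure.map_apply hm (hA.prod hB), Measure.compProd_apply_prod hA hB,
    setLIntegral_map hA ((κ n).measurable_coe hB) (measurable_history n)] at h1
  refine Eq.trans h1.symm (lintegral_congr fun ω => ?_)
  rw [hκ]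
  rfl

lemma map_zero_trajMeasure (κ : (n : ℕ) → Kernel ((i : Finset.Iic n) → Z) Z)
    [∀ n, IsMarkovKernel (κ n)] (μ : Measure Z) :
    (Kernel.trajMeasure (X := fun _ => Z) μ κ).map (fun ω => ω 0) = μ := by
  have h0 : (Kernel.trajMeasure (X := fun _ => Z) μ κ).map (history 0) =
      μ.map (fun z _ => z) := by
    refine (Measure.map_comp _ _ (Preorder.measurable_frestrictLe 0)).trans ?_
    rw [Kernel.traj_map_frestrictLe, Kernel.partialTraj_self, Measure.id_comp]
    rfl
  have hm : Measurable (fun (z : Z) (_ : Finset.Iic 0) => z) :=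
    measurable_pi_lambda _ fun _ => measurable_id
  have he : Measurable fun h : (i : Finset.Iic 0) → Z => h ⟨0, Finset.mem_Iic.2 le_rfl⟩ :=
    measurable_pi_apply _
  have h1 : (fun ω : ℕ → Z => ω 0) =
      (fun h : (i : Finset.Iic 0) → Z => h ⟨0, Finset.mem_Iic.2 le_rfl⟩) ∘ history 0 := rfl
  rw [h1, ← Measure.map_map he (measurable_history 0), h0, Measure.map_map he hm]
  exact Measure.map_id

lemma chainLaw_apply (K : Kernel Z Z) [IsMarkovKernel K] (z : Z) :
    chainLaw K z = Kernel.trajMeasure (X := fun _ => Z) (Measure.dirac z)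
      (fun n => K.comap (fun h => h ⟨n, Finset.mem_Iic.2 le_rfl⟩) (measurable_pi_apply _)) := by
  have hm : Measurable (MeasurableEquiv.piUnique fun _ : Finset.Iic 0 => Z).symm :=
    MeasurableEquiv.measurable _
  refine Eq.symm ((congrArg (Measure.bind · _) (Measure.map_dirac' hm z)).trans ?_)
  exact Measure.dirac_bind (Kernel.measurable _) _

lemma isMarkovLaw_chainLaw (K : Kernel Z Z) [IsMarkovKernel K] (z : Z) :
    IsMarkovLaw K (chainLaw K z) := by
  rw [chainLaw_apply]
  exact isMarkovLaw_trajMeasure K _ (fun _ _ => rfl) _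

lemma map_zero_chainLaw (K : Kernel Z Z) [IsMarkovKernel K] (z : Z) :
    (chainLaw K z).map (fun ω => ω 0) = Measure.dirac z := by
  rw [chainLaw_apply]
  exact map_zero_trajMeasure _ _

/-- The identity defining a Markov law is linear in the law, so it survives mixing over the initial
state. -/
lemma isMarkovLaw_bind_chainLaw (K : Kernel Z Z) [IsMarkovKernel K] (μ : Measure Z) :
    IsMarkovLaw K (μ.bind (chainLaw K)) := by
  intro n A hA B hB
  have hAm : MeasurableSet (history n ⁻¹' A) := measurable_history n hA
  have hBm : MeasurableSet {ω : ℕ → Z | ω (n + 1) ∈ B} := measurable_pi_apply (n + 1) hB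
  have hg : Measurable fun ω : ℕ → Z => K (ω n) B :=
    (K.measurable_coe hB).comp (measurable_pi_apply n)
  rw [Measure.bind_apply (hAm.inter hBm) (Kernel.measurable _).aemeasurable,
    ← lintegral_indicator hAm,
    Measure.lintegral_bind (Kernel.measurable _).aemeasurable (hg.indicator hAm).aemeasurable]
  refine lintegral_congr fun z => ?_
  rw [isMarkovLaw_chainLaw K z n A hA B hB, lintegral_indicator hAm]

lemma map_zero_bind_chainLaw (K : Kernel Z Z) [IsMarkovKernel K] (μ : Measure Z) :
    (μ.bind (chainLaw K)).map (fun ω => ω 0) = μ := by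
  ext B hB
  rw [Measure.map_apply (measurable_pi_apply 0) hB,
    Measure.bind_apply (measurable_pi_apply 0 hB) (Kernel.measurable _).aemeasurable,
    ← lintegral_indicator_one hB]
  refine lintegral_congr fun z => ?_
  rw [← Measure.map_apply (measurable_pi_apply 0) hB, map_zero_chainLaw, Measure.dirac_apply' _ hB]

/-- A finite Markov law is a mixture of the laws started from the different states. -/
theorem IsMarkovLaw.eq_bind {K : Kernel Z Z} [IsMarkovKernel K] {Q : Measure (ℕ → Z)}
    [IsFiniteMeasure Q] (hQ : IsMarkovLaw K Q) :
    Q = (Q.map fun ω => ω 0).bind (chainLaw K) :=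
  hQ.unique (isMarkovLaw_bind_chainLaw K _) (map_zero_bind_chainLaw K _).symm

/-- The marginal of a Markov law at time `n + 1`. -/
lemma IsMarkovLaw.map_succ {K : Kernel Z Z} {Q : Measure (ℕ → Z)} (hQ : IsMarkovLaw K Q) (n : ℕ) :
    Q.map (fun ω => ω (n + 1)) = (Q.map fun ω => ω n).bind K := by
  ext B hB
  have h := hQ n Set.univ MeasurableSet.univ B hB
  rw [Set.preimage_univ, Set.univ_inter, Measure.restrict_univ] at h
  rw [Measure.map_apply (measurable_pi_apply _) hB, Measure.bind_apply hB K.aemeasurable,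
    lintegral_map (K.measurable_coe hB) (measurable_pi_apply n)]
  exact h

/-- The Markov property for shift invariant events. -/
theorem IsMarkovLaw.measure_inter_invariant {K : Kernel Z Z} [IsMarkovKernel K]
    {Q : Measure (ℕ → Z)} [IsFiniteMeasure Q] (hQ : IsMarkovLaw K Q) {C : Set (ℕ → Z)}
    (hC : MeasurableSet C) (hCinv : shift 1 ⁻¹' C = C) (t : ℕ)
    {F : Set ((i : Finset.Iic t) → Z)} (hF : MeasurableSet F) :
    Q (C ∩ history t ⁻¹' F) = ∫⁻ ω in history t ⁻¹' F, chainLaw K (ω t) C ∂Q := by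
  -- On the event F the path after time t is a mixture of chains started from ω t, and a shift
  -- invariant C does not distinguish the path from its shift.
  have h := (hQ.restrict_map_shift t hF).eq_bind
  rw [Measure.map_map (measurable_pi_apply 0) (measurable_shift t)] at h
  have h1 := congrArg (fun m => m C) h
  rw [Measure.map_apply (measurable_shift t) hC, preimage_shift_eq_self hCinv,
    Measure.restrict_apply hC, Measure.bind_apply hC (Kernel.measurable _).aemeasurable,
    lintegral_map ((chainLaw K).measurable_coe hC)
      ((measurable_pi_apply 0).comp (measurable_shift t))] at h1
  exact h1

end Chain

/-! ### Ergodicity of a chain with a unique invariant probability measure -/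

section ChainErgodic

variable {Z : Type*} [MeasurableSpace Z] {K : Kernel Z Z} [IsMarkovKernel K]

/-- The Markov property at time 1: the probability of an invariant event is a harmonic function of
the initial state. -/
lemma chainLaw_invariant_eq_lintegral {C : Set (ℕ → Z)} (hC : MeasurableSet C)
    (hCinv : shift 1 ⁻¹' C = C) (z : Z) :
    chainLaw K z C = ∫⁻ w, chainLaw K w C ∂(K z) := by
  have h := (isMarkovLaw_chainLaw K z).measure_inter_invariant hC hCinv 1 MeasurableSet.univ
  rw [Set.preimage_univ, Set.inter_univ, Measure.restrict_univ] at h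
  rw [h, ← lintegral_map (μ := chainLaw K z) ((chainLaw K).measurable_coe hC)
    (measurable_pi_apply 1), (isMarkovLaw_chainLaw K z).map_succ 0, map_zero_chainLaw,
    Measure.dirac_bind K.measurable]

/-- A bounded harmonic function is almost surely constant along the steps of a stationary
chain. -/
lemma ae_eq_of_harmonic {ν : Measure Z} [IsProbabilityMeasure ν] (hν : K.Invariant ν)
    {g : Z → ℝ} (hg : Measurable g) (hb : ∀ z, |g z| ≤ 1) (hK : ∀ z, g z = ∫ w, g w ∂(K z)) :
    ∀ᵐ p ∂(ν ⊗ₘ K), g p.1 = g p.2 := by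
  have hbd : ∀ {h : Z × Z → ℝ}, Measurable h → (∀ p, |h p| ≤ 1) → Integrable h (ν ⊗ₘ K) :=
    fun hm hh => Integrable.of_bound hm.aestronglyMeasurable 1 (Eventually.of_forall hh)
  have hmul : ∀ a b : Z, |g a * g b| ≤ 1 := fun a b => by
    rw [abs_mul]; exact mul_le_one₀ (hb a) (abs_nonneg _) (hb b)
  have hg1 : Measurable fun p : Z × Z => g p.1 := hg.comp measurable_fst
  have hg2 : Measurable fun p : Z × Z => g p.2 := hg.comp measurable_snd
  have i11 : Integrable (fun p : Z × Z => g p.1 * g p.1) (ν ⊗ₘ K) :=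
    hbd (hg1.mul hg1) fun p => hmul p.1 p.1
  have i12 : Integrable (fun p : Z × Z => g p.1 * g p.2) (ν ⊗ₘ K) :=
    hbd (hg1.mul hg2) fun p => hmul p.1 p.2
  have i22 : Integrable (fun p : Z × Z => g p.2 * g p.2) (ν ⊗ₘ K) :=
    hbd (hg2.mul hg2) fun p => hmul p.2 p.2
  have e11 : ∫ p, g p.1 * g p.1 ∂(ν ⊗ₘ K) = ∫ z, g z * g z ∂ν := by
    rw [Measure.integral_compProd i11]; simp
  have e12 : ∫ p, g p.1 * g p.2 ∂(ν ⊗ₘ K) = ∫ z, g z * g z ∂ν := by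
    rw [Measure.integral_compProd i12]
    refine integral_congr_ae (Eventually.of_forall fun z => ?_)
    simp only
    rw [integral_const_mul, ← hK]
  have e22 : ∫ p, g p.2 * g p.2 ∂(ν ⊗ₘ K) = ∫ z, g z * g z ∂ν := by
    have hs : (ν ⊗ₘ K).map Prod.snd = ν := (Measure.snd_compProd ν K).trans hν
    conv_rhs => rw [← hs]
    exact (integral_map measurable_snd.aemeasurable (hg.mul hg).aestronglyMeasurable).symm
  -- Expanding the square, all the terms equal ∫ g² dν up to sign and cancel: the cross term by
  -- harmonicity, the square at the second coordinate by invariance.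
  have hsq : ∫ p, (g p.1 - g p.2) ^ 2 ∂(ν ⊗ₘ K) = 0 := by
    have : (fun p : Z × Z => (g p.1 - g p.2) ^ 2) =
        fun p => (g p.1 * g p.1 - g p.1 * g p.2) - (g p.1 * g p.2 - g p.2 * g p.2) := by
      funext p; ring
    have s1 : Integrable (fun p : Z × Z => g p.1 * g p.1 - g p.1 * g p.2) (ν ⊗ₘ K) := i11.sub i12
    have s2 : Integrable (fun p : Z × Z => g p.1 * g p.2 - g p.2 * g p.2) (ν ⊗ₘ K) := i12.sub i22
    rw [this, integral_sub s1 s2, integral_sub i11 i12, integral_sub i12 i22,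
      e11, e12, e22]
    ring
  have hi : Integrable (fun p : Z × Z => (g p.1 - g p.2) ^ 2) (ν ⊗ₘ K) := by
    refine ((i11.sub i12).sub (i12.sub i22)).congr (Eventually.of_forall fun p => ?_)
    simp only [Pi.sub_apply]
    ring
  filter_upwards [(integral_eq_zero_iff_of_nonneg (fun p => sq_nonneg _) hi).1 hsq] with p hp
  exact sub_eq_zero.1 (pow_eq_zero_iff two_ne_zero |>.1 hp)

/-- The probability of a shift invariant event is almost surely independent of the initial state
if the invariant probability measure is unique. -/
lemma chainLaw_invariant_ae_const {ν : Measure Z} (hν : IsUniqueInvariant K ν)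
    {C : Set (ℕ → Z)} (hC : MeasurableSet C) (hCinv : shift 1 ⁻¹' C = C) :
    ∀ᵐ z ∂ν, chainLaw K z C = ν.bind (chainLaw K) C := by
  obtain ⟨hprob, hinv, huniq⟩ := hν
  set g : Z → ℝ≥0∞ := fun z => chainLaw K z C with hgdef
  have hgm : Measurable g := (chainLaw K).measurable_coe hC
  have hg1 : ∀ z, g z ≤ 1 := fun z => prob_le_one
  have hp : ν.bind (chainLaw K) C = ∫⁻ z, g z ∂ν :=
    Measure.bind_apply hC (Kernel.measurable _).aemeasurable
  rw [hp]
  set p := ∫⁻ z, g z ∂ν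
  have hp1 : p ≤ 1 := by
    calc p ≤ ∫⁻ _, 1 ∂ν := lintegral_mono hg1
      _ = 1 := by simp
  have hptop : p ≠ ∞ := ne_top_of_le_ne_top ENNReal.one_ne_top hp1
  rcases eq_or_ne p 0 with h0 | h0
  · rw [h0]
    exact (lintegral_eq_zero_iff hgm).1 h0
  have hharm : ∀ z, (g z).toReal = ∫ w, (g w).toReal ∂(K z) := fun z => by
    rw [integral_toReal hgm.aemeasurable
      (Eventually.of_forall fun w => (hg1 w).trans_lt ENNReal.one_lt_top)]
    congr 1
    exact chainLaw_invariant_eq_lintegral hC hCinv z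
  have hae : ∀ᵐ q ∂(ν ⊗ₘ K), g q.1 = g q.2 := by
    filter_upwards [ae_eq_of_harmonic hinv hgm.ennreal_toReal
      (fun z => by
        rw [abs_of_nonneg ENNReal.toReal_nonneg]
        exact ENNReal.toReal_mono ENNReal.one_ne_top (hg1 z)) hharm] with q hq
    exact (ENNReal.toReal_eq_toReal_iff' (ne_top_of_le_ne_top ENNReal.one_ne_top (hg1 _))
      (ne_top_of_le_ne_top ENNReal.one_ne_top (hg1 _))).1 hq
  -- Since g agrees at both ends of almost every step, the weight can be moved from the starting
  -- point (`e1`) to the end point (`e2`), where invariance of ν applies.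
  have hbind : (ν.withDensity g).bind K = ν.withDensity g := by
    ext B hB
    have hBm : Measurable fun z => K z B := K.measurable_coe hB
    rw [Measure.bind_apply hB K.aemeasurable, withDensity_apply _ hB,
      lintegral_withDensity_eq_lintegral_mul _ hgm hBm]
    have e1 : ∫⁻ q, g q.1 * B.indicator 1 q.2 ∂(ν ⊗ₘ K) = ∫⁻ z, (g * fun z => K z B) z ∂ν := by
      have hm : Measurable fun q : Z × Z => g q.1 * B.indicator 1 q.2 :=
        (hgm.comp measurable_fst).mul ((measurable_one.indicator hB).comp measurable_snd)
      rw [Measure.lintegral_compProd hm]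
      refine lintegral_congr fun z => ?_
      dsimp only
      rw [lintegral_const_mul _ (measurable_one.indicator hB), lintegral_indicator_one hB]
      rfl
    have e2 : ∫⁻ q, g q.2 * B.indicator 1 q.2 ∂(ν ⊗ₘ K) = ∫⁻ z in B, g z ∂ν := by
      have hs : (ν ⊗ₘ K).map Prod.snd = ν := (Measure.snd_compProd ν K).trans hinv
      rw [← lintegral_map (f := fun z => g z * B.indicator 1 z)
        (hgm.mul (measurable_one.indicator hB)) measurable_snd, hs, ← lintegral_indicator hB]
      refine lintegral_congr fun z => ?_
      by_cases hz : z ∈ B <;> simp [hz]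
    rw [← e1, ← e2]
    refine lintegral_congr_ae ?_
    filter_upwards [hae] with q hq
    rw [hq]
  have hnorm : p⁻¹ • ν.withDensity g = ν := by
    refine huniq _ ⟨?_⟩ ?_
    · rw [Measure.smul_apply, withDensity_apply _ MeasurableSet.univ, Measure.restrict_univ,
        smul_eq_mul, ENNReal.inv_mul_cancel h0 hptop]
    · change (p⁻¹ • ν.withDensity g).bind K = _
      rw [Measure.bind_smul, hbind]
  -- Uniqueness identifies the normalized weighted measure with ν, so g and the constant p are
  -- densities of the same measure.
  have hdens : ν.withDensity g = ν.withDensity fun _ => p := by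
    rw [withDensity_const]
    conv_rhs => rw [← hnorm]
    rw [smul_smul, ENNReal.mul_inv_cancel h0 hptop, one_smul]
  exact (withDensity_eq_iff hgm.aemeasurable aemeasurable_const hptop).1 hdens

lemma map_eval_bind_chainLaw {ν : Measure Z} (hν : K.Invariant ν) (n : ℕ) :
    (ν.bind (chainLaw K)).map (fun ω => ω n) = ν := by
  induction n with
  | zero => exact map_zero_bind_chainLaw K ν
  | succ n ih => rw [(isMarkovLaw_bind_chainLaw K ν).map_succ n, ih, hν.def]

/-- The stationary chain is ergodic if its invariant probability measure is unique. -/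
theorem ergodic_shift_of_isUniqueInvariant {ν : Measure Z} (hν : IsUniqueInvariant K ν) :
    Ergodic (shift 1) (ν.bind (chainLaw K)) := by
  have hprob := hν.1
  have hM := isMarkovLaw_bind_chainLaw K ν
  set P := ν.bind (chainLaw K) with hP
  refine ⟨⟨measurable_shift 1, ?_⟩, ⟨fun C hC hCinv => ?_⟩⟩
  · have h := hM.restrict_map_shift 1 (F := Set.univ) MeasurableSet.univ
    rw [Set.preimage_univ, Measure.restrict_univ] at h
    refine h.unique hM ?_
    rw [Measure.map_map (measurable_pi_apply 0) (measurable_shift 1), map_zero_bind_chainLaw]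
    exact map_eval_bind_chainLaw hν.2.1 1
  · have hconst := chainLaw_invariant_ae_const hν hC hCinv
    have hgm : Measurable fun z => chainLaw K z C := (chainLaw K).measurable_coe hC
    have hfin : IsFiniteMeasure (P C • P) := Measure.smul_finite P (measure_ne_top P C)
    -- An invariant event is independent of every finite history, because its conditional
    -- probability is almost surely the constant P(C). Hence it is independent of itself, and P(C) =
    -- P(C)².
    have hkey : P.restrict C = P C • P := by
      refine ext_of_map_history fun t => Measure.ext fun F hF => ?_
      have hFm := measurable_history t hF
      rw [Measure.map_apply (measurable_history t) hF, Measure.map_apply (measurable_history t) hF,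
        Measure.restrict_apply hFm, Set.inter_comm, hM.measure_inter_invariant hC hCinv t hF,
        Measure.smul_apply, smul_eq_mul]
      have hae : ∀ᵐ ω ∂P, chainLaw K (ω t) C = P C := by
        have : ∀ᵐ z ∂(P.map fun ω => ω t), chainLaw K z C = P C := by
          rw [map_eval_bind_chainLaw hν.2.1 t]; exact hconst
        exact ae_of_ae_map (measurable_pi_apply t).aemeasurable this
      rw [lintegral_congr_ae (ae_restrict_of_ae hae), setLIntegral_const]
    have hsq := congrArg (fun m => m C) hkey
    simp only [Measure.smul_apply, smul_eq_mul, Measure.restrict_apply hC, Set.inter_self] at hsq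
    rcases eq_or_ne (P C) 0 with h0 | h0
    · exact eventuallyConst_set'.2 (Or.inl (ae_eq_empty.2 h0))
    · have h1 : P C = 1 := by
        have h2 : P C * 1 = P C * P C := by rw [mul_one]; exact hsq
        exact ((ENNReal.mul_right_inj h0 (measure_ne_top P C)).1 h2).symm
      exact eventuallyConst_set'.2 (Or.inr (eventuallyEq_univ.2 ((prob_compl_eq_zero_iff hC).2 h1)))

/-- The strong law of large numbers for a chain with a unique invariant probability measure, for
every initial law from which all sets of full measure are entered. -/
theorem IsMarkovLaw.ae_tendsto_average {ν : Measure Z} (hν : IsUniqueInvariant K ν)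
    {Q : Measure (ℕ → Z)} [IsProbabilityMeasure Q] (hQ : IsMarkovLaw K Q)
    (hhit : ∀ A : Set Z, MeasurableSet A → ν A = 1 → ∀ᵐ ω ∂Q, ∃ t, ω t ∈ A)
    {f : Z × Z → ℝ} (hf : Measurable f) {B : ℝ} (hB : ∀ p, |f p| ≤ B) :
    ∀ᵐ ω ∂Q, Tendsto (fun n : ℕ => (n : ℝ)⁻¹ * ∑ k ∈ Finset.range n, f (ω k, ω (k + 1))) atTop
      (𝓝 (∫ p, f p ∂(ν ⊗ₘ K))) := by
  have hprob := hν.1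
  have hM := isMarkovLaw_bind_chainLaw K ν
  set P := ν.bind (chainLaw K) with hP
  set m := ∫ p, f p ∂(ν ⊗ₘ K)
  have hpair : Measurable fun ω : ℕ → Z => (ω 0, ω 1) :=
    (measurable_pi_apply 0).prodMk (measurable_pi_apply 1)
  set F : (ℕ → Z) → ℝ := fun ω => f (ω 0, ω 1)
  have hF : Measurable F := hf.comp hpair
  set C : Set (ℕ → Z) :=
    {ω | Tendsto (fun n => birkhoffAverage ℝ (shift 1) F n ω) atTop (𝓝 m)} with hCdef
  have havg : ∀ ω n, birkhoffAverage ℝ (shift 1) F n ω =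
      (n : ℝ)⁻¹ * ∑ k ∈ Finset.range n, f (ω k, ω (k + 1)) := fun ω n => by
    simp only [birkhoffAverage, birkhoffSum, smul_eq_mul, iterate_shift_one]
    rfl
  have hC : MeasurableSet C := by
    refine measurableSet_tendsto_fun (fun n => ?_) measurable_const
    have : birkhoffAverage ℝ (shift 1) F n =
        fun ω => (n : ℝ)⁻¹ * ∑ k ∈ Finset.range n, f (ω k, ω (k + 1)) := funext fun ω => havg ω n
    rw [this]
    exact measurable_const.mul (Finset.measurable_sum _ fun k _ =>
      hf.comp ((measurable_pi_apply k).prodMk (measurable_pi_apply (k + 1))))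
  have hbF : ∀ ω, |F ω| ≤ B := fun ω => hB _
  -- Shifting the path alters the sum only in its first and last terms, which are bounded, so the
  -- averages change by a vanishing amount.
  have hCinv : shift 1 ⁻¹' C = C := by
    ext ω
    have hdiff : Tendsto (fun n => birkhoffAverage ℝ (shift 1) F n (shift 1 ω) -
        birkhoffAverage ℝ (shift 1) F n ω) atTop (𝓝 0) := by
      refine tendsto_birkhoffAverage_apply_sub_birkhoffAverage ℝ ?_
      refine Metric.isBounded_range_iff.2 ⟨B + B, fun i j => ?_⟩
      rw [Real.dist_eq]
      exact (abs_sub _ _).trans (add_le_add (hbF _) (hbF _))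
    constructor
    · intro h
      have := h.sub hdiff
      simpa [hCdef] using this
    · intro h
      have := hdiff.add h
      simpa [hCdef] using this
  have hlaw : P.map (fun ω => (ω 0, ω 1)) = ν ⊗ₘ K := by
    refine Measure.ext_prod fun {A B} hA hB => ?_
    have hm : Measurable fun h : (i : Finset.Iic 0) → Z => h ⟨0, Finset.mem_Iic.2 le_rfl⟩ :=
      measurable_pi_apply _
    rw [Measure.map_apply hpair (hA.prod hB), Measure.compProd_apply_prod hA hB]
    have h := hM 0 _ (hm hA) B hB
    refine h.trans ?_
    conv_rhs => rw [← map_eval_bind_chainLaw hν.2.1 0]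
    exact (setLIntegral_map hA (K.measurable_coe hB) (measurable_pi_apply 0)).symm
  have hPC : ∀ᵐ ω ∂P, ω ∈ C := by
    have h := ae_tendsto_birkhoffAverage (ergodic_shift_of_isUniqueInvariant hν) hF
      (Integrable.of_bound hF.aestronglyMeasurable B (Eventually.of_forall hbF))
    have hm : ∫ ω, F ω ∂P = m := by
      rw [← integral_map (f := f) hpair.aemeasurable hf.aestronglyMeasurable, hlaw]
    rwa [hm] at h
  -- The good initial states, from which the averages almost surely converge. They have full
  -- measure, since the stationary chain is a mixture over its initial state.
  set A : Set Z := {z | chainLaw K z Cᶜ = 0}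
  have hgm : Measurable fun z => chainLaw K z Cᶜ := (chainLaw K).measurable_coe hC.compl
  have hA : MeasurableSet A := hgm (measurableSet_singleton 0)
  have hνA : ν A = 1 := by
    have h0 : P Cᶜ = 0 := hPC
    rw [hP, Measure.bind_apply hC.compl (Kernel.measurable _).aemeasurable,
      lintegral_eq_zero_iff hgm] at h0
    exact prob_compl_eq_zero_iff hA |>.1 h0
  have hCcinv : shift 1 ⁻¹' Cᶜ = Cᶜ := by rw [Set.preimage_compl, hCinv]
  -- Restarting at time t in a good state gives convergence for the shifted path, hence for the path
  -- itself by invariance of C.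
  have hzero : ∀ t, ∀ᵐ ω ∂Q, ω t ∈ A → ω ∈ C := fun t => by
    have hm : Measurable fun h : (i : Finset.Iic t) → Z => h ⟨t, Finset.mem_Iic.2 le_rfl⟩ :=
      measurable_pi_apply _
    have h := hQ.measure_inter_invariant hC.compl hCcinv t (hm hA)
    have h2 : ∫⁻ ω in history t ⁻¹' ((fun h => h ⟨t, Finset.mem_Iic.2 le_rfl⟩) ⁻¹' A),
        chainLaw K (ω t) Cᶜ ∂Q = 0 := by
      refine (setLIntegral_congr_fun (g := fun _ => 0) (measurable_history t (hm hA))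
        fun ω hω => hω).trans ?_
      simp
    rw [h2] at h
    refine measure_mono_null (fun ω hω => ?_) h
    have h3 : ¬(ω t ∈ A → ω ∈ C) := hω
    push Not at h3
    exact ⟨h3.2, h3.1⟩
  filter_upwards [hhit A hA hνA, ae_all_iff.2 hzero] with ω ⟨t, ht⟩ h
  have := h t ht
  simp only [hCdef, Set.mem_ofPred_eq, havg] at this
  exact this

end ChainErgodic

/-! ### Convergence of averaged fixed point iterations -/

section Averaging

variable {I : Type*} [Fintype I] {Δ W a : ℕ → I → ℝ} {β : ℝ}

/-- The bound is the fixed point of x ↦ w + βx, and it propagates by strong induction because the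
weights, divided by 1 plus their sum, have total mass at most 1. -/
lemma norm_bounded_of_weighted_average (hβ0 : 0 < β) (hβ1 : β < 1) (ha : ∀ k i, 0 ≤ a k i)
    (h : ∀ t i, |Δ t i| ≤ |W t i| +
      β * ((∑ k ∈ Finset.range t, a k i * ‖Δ k‖) / (1 + ∑ k ∈ Finset.range t, a k i)))
    {w : ℝ} (hw0 : 0 ≤ w) (hw : ∀ t i, |W t i| ≤ w) (t : ℕ) : ‖Δ t‖ ≤ w / (1 - β) := by
  have hβ : 0 < 1 - β := by linarith
  induction t using Nat.strong_induction_on with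
  | _ t ih =>
    refine (pi_norm_le_iff_of_nonneg (div_nonneg hw0 hβ.le)).2 fun i => ?_
    have hS : 0 ≤ ∑ k ∈ Finset.range t, a k i := Finset.sum_nonneg fun k _ => ha k i
    have hB : 0 ≤ w / (1 - β) := div_nonneg hw0 hβ.le
    have h1 : (∑ k ∈ Finset.range t, a k i * ‖Δ k‖) / (1 + ∑ k ∈ Finset.range t, a k i) ≤
        w / (1 - β) := by
      rw [div_le_iff₀ (by linarith)]
      calc ∑ k ∈ Finset.range t, a k i * ‖Δ k‖
          ≤ ∑ k ∈ Finset.range t, a k i * (w / (1 - β)) :=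
            Finset.sum_le_sum fun k hk =>
              mul_le_mul_of_nonneg_left (ih k (Finset.mem_range.1 hk)) (ha k i)
        _ = (w / (1 - β)) * ∑ k ∈ Finset.range t, a k i := by rw [← Finset.sum_mul, mul_comm]
        _ ≤ (w / (1 - β)) * (1 + ∑ k ∈ Finset.range t, a k i) :=
            mul_le_mul_of_nonneg_left (by linarith) hB
    calc ‖Δ t i‖ ≤ |W t i| + β * ((∑ k ∈ Finset.range t, a k i * ‖Δ k‖) /
          (1 + ∑ k ∈ Finset.range t, a k i)) := h t i
      _ ≤ w + β * (w / (1 - β)) := add_le_add (hw t i) (mul_le_mul_of_nonneg_left h1 hβ0.le)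
      _ = w / (1 - β) := by field_simp; ring

/-- The errors before the bound D sets in contribute a fixed sum, which the diverging total weight
washes out; the later ones contribute at most βD. The noise vanishes, so any D' > βD is an eventual
bound. -/
lemma eventually_norm_le_of_weighted_average (hβ0 : 0 < β) (ha : ∀ k i, 0 ≤ a k i)
    (hS : ∀ i, Tendsto (fun t => ∑ k ∈ Finset.range t, a k i) atTop atTop)
    (h : ∀ t i, |Δ t i| ≤ |W t i| +
      β * ((∑ k ∈ Finset.range t, a k i * ‖Δ k‖) / (1 + ∑ k ∈ Finset.range t, a k i)))
    (hW : ∀ i, Tendsto (fun t => W t i) atTop (𝓝 0)) {D D' : ℝ} (hD : 0 ≤ D) (hD' : β * D < D')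
    (hev : ∀ᶠ t in atTop, ‖Δ t‖ ≤ D) : ∀ᶠ t in atTop, ‖Δ t‖ ≤ D' := by
  obtain ⟨k₀, hk₀⟩ := eventually_atTop.1 hev
  have hcoord : ∀ i, ∀ᶠ t in atTop, |Δ t i| ≤ D' := fun i => by
    set C₀ := ∑ k ∈ Finset.range k₀, a k i * ‖Δ k‖
    have hlim : Tendsto (fun t => |W t i| +
        β * (C₀ / (1 + ∑ k ∈ Finset.range t, a k i) + D)) atTop (𝓝 (|0| + β * (0 + D))) :=
      (hW i).abs.add (((tendsto_const_nhds.div_atTop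
        (tendsto_atTop_add_const_left _ 1 (hS i))).add_const D).const_mul β)
    rw [abs_zero, zero_add, zero_add] at hlim
    filter_upwards [hlim.eventually_lt_const hD', eventually_ge_atTop k₀] with t ht htk
    refine (h t i).trans (le_trans ?_ ht.le)
    refine add_le_add le_rfl (mul_le_mul_of_nonneg_left ?_ hβ0.le)
    have hSt : 0 ≤ ∑ k ∈ Finset.range t, a k i := Finset.sum_nonneg fun k _ => ha k i
    have hpos : 0 < 1 + ∑ k ∈ Finset.range t, a k i := by linarith
    rw [div_le_iff₀ hpos, add_mul, div_mul_cancel₀ _ hpos.ne',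
      ← Finset.sum_range_add_sum_Ico _ htk]
    refine add_le_add le_rfl ?_
    calc ∑ k ∈ Finset.Ico k₀ t, a k i * ‖Δ k‖
        ≤ ∑ k ∈ Finset.Ico k₀ t, a k i * D := Finset.sum_le_sum fun k hk =>
          mul_le_mul_of_nonneg_left (hk₀ k (Finset.mem_Ico.1 hk).1) (ha k i)
      _ = D * ∑ k ∈ Finset.Ico k₀ t, a k i := by rw [← Finset.sum_mul, mul_comm]
      _ ≤ _ := by
        refine mul_le_mul_of_nonneg_left ?_ hD
        have : 0 ≤ ∑ k ∈ Finset.range k₀, a k i := Finset.sum_nonneg fun k _ => ha k i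
        rw [← Finset.sum_range_add_sum_Ico _ htk]
        linarith
  have hD'0 : 0 ≤ D' := (mul_nonneg hβ0.le hD).trans hD'.le
  filter_upwards [eventually_all.2 hcoord] with t ht
  exact (pi_norm_le_iff_of_nonneg hD'0).2 ht

/-- Errors which are bounded by a vanishing noise plus `β` times a weighted average of the past
errors vanish. -/
theorem tendsto_zero_of_weighted_average (hβ0 : 0 < β) (hβ1 : β < 1) (ha : ∀ k i, 0 ≤ a k i)
    (hS : ∀ i, Tendsto (fun t => ∑ k ∈ Finset.range t, a k i) atTop atTop)
    (h : ∀ t i, |Δ t i| ≤ |W t i| +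
      β * ((∑ k ∈ Finset.range t, a k i * ‖Δ k‖) / (1 + ∑ k ∈ Finset.range t, a k i)))
    (hW : ∀ i, Tendsto (fun t => W t i) atTop (𝓝 0)) :
    Tendsto (fun t => ‖Δ t‖) atTop (𝓝 0) := by
  obtain ⟨w, hw0, hw⟩ : ∃ w : ℝ, 0 ≤ w ∧ ∀ t i, |W t i| ≤ w := by
    have hb : ∀ i, ∃ w : ℝ, ∀ t, |W t i| ≤ w := fun i => by
      obtain ⟨w, hw⟩ := (hW i).abs.bddAbove_range
      exact ⟨w, fun t => hw ⟨t, rfl⟩⟩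
    choose w hw using hb
    exact ⟨∑ i, |w i|, Finset.sum_nonneg fun i _ => abs_nonneg _, fun t i =>
      ((hw i t).trans (le_abs_self _)).trans
        (Finset.single_le_sum (f := fun i => |w i|) (fun i _ => abs_nonneg _) (Finset.mem_univ i))⟩
  have hbd := norm_bounded_of_weighted_average hβ0 hβ1 ha h hw0 hw
  -- The summand 1 makes D positive and r = (1 + β)/2 exceeds β, so that the strict inequality β(r^n
  -- D) < r^(n+1) D needed for each improvement holds.
  set D := w / (1 - β) + 1 with hDdef
  have hDpos : 0 < D := by
    have : 0 ≤ w / (1 - β) := div_nonneg hw0 (by linarith)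
    linarith
  set r := (1 + β) / 2 with hr
  have hr0 : 0 < r := by rw [hr]; linarith
  have hr1 : r < 1 := by rw [hr]; linarith
  have hiter : ∀ n : ℕ, ∀ᶠ t in atTop, ‖Δ t‖ ≤ r ^ n * D := fun n => by
    induction n with
    | zero =>
      refine Eventually.of_forall fun t => (hbd t).trans ?_
      rw [pow_zero, one_mul, hDdef]
      linarith
    | succ n ih =>
      have hpos : 0 < r ^ n * D := mul_pos (pow_pos hr0 n) hDpos
      refine eventually_norm_le_of_weighted_average hβ0 ha hS h hW hpos.le ?_ ih
      rw [pow_succ', mul_assoc]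
      exact mul_lt_mul_of_pos_right (by rw [hr]; linarith) hpos
  rw [Metric.tendsto_nhds]
  intro ε hε
  have hgeo : Tendsto (fun n : ℕ => r ^ n * D) atTop (𝓝 (0 * D)) :=
    (tendsto_pow_atTop_nhds_zero_of_lt_one hr0.le hr1).mul_const D
  rw [zero_mul] at hgeo
  obtain ⟨n, hn⟩ := (hgeo.eventually_lt_const hε).exists
  filter_upwards [hiter n] with t ht
  rw [Real.dist_eq, sub_zero, abs_of_nonneg (norm_nonneg _)]
  exact ht.trans_lt hn

end Averaging

lemma abs_ciInf_sub_ciInf_le {U : Type*} [Finite U] [Nonempty U] {f g : U → ℝ} {B : ℝ}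
    (h : ∀ v, |f v - g v| ≤ B) : |(⨅ v, f v) - ⨅ v, g v| ≤ B := by
  have key : ∀ f g : U → ℝ, (∀ v, |f v - g v| ≤ B) → (⨅ v, f v) - ⨅ v, g v ≤ B := by
    intro f g h
    rw [sub_le_iff_le_add, ← sub_le_iff_le_add']
    refine le_ciInf fun v => ?_
    have h1 : ⨅ v, f v ≤ f v := ciInf_le (Set.finite_range f).bddBelow v
    have h2 := (abs_le.1 (h v)).2
    linarith
  rw [abs_le]
  refine ⟨?_, key f g h⟩
  have := key g f fun v => by rw [abs_sub_comm]; exact h v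
  linarith

/-! ### Pathwise convergence of quantized Q-learning -/

section QLearning

variable {S U : Type*} {M : ℕ}

open Classical in
/-- The indicator function of the visits to the pair `(y, u)`. -/
noncomputable def visit (q : S → Fin M) (y : Fin M) (u : U) (z : S × U) : ℝ :=
  if q z.1 = y ∧ z.2 = u then 1 else 0

lemma visit_nonneg (q : S → Fin M) (y : Fin M) (u : U) (z : S × U) : 0 ≤ visit q y u z := by
  unfold visit; split_ifs <;> norm_num

/-- The count in the step size includes the visit at time t itself, hence the 2 in front of the
visits strictly before t. Off the visits both sides vanish. -/
lemma stepSize_eq (q : S → Fin M) (ω : ℕ → S × U) (t : ℕ) (y : Fin M) (u : U) :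
    stepSize q ω t y u =
      visit q y u (ω t) / (2 + ∑ k ∈ Finset.range t, visit q y u (ω k)) := by
  classical
  unfold stepSize
  by_cases h : q (ω t).1 = y ∧ (ω t).2 = u
  · have h1 : (((Finset.range (t + 1)).filter
        (fun k => q (ω k).1 = y ∧ (ω k).2 = u)).card : ℝ) =
        ∑ k ∈ Finset.range (t + 1), visit q y u (ω k) := by
      rw [Finset.card_filter]
      push_cast
      rfl
    have h2 : visit q y u (ω t) = 1 := if_pos h
    rw [if_pos h, h1, Finset.sum_range_succ, h2]
    congr 1
    ring
  · have h2 : visit q y u (ω t) = 0 := if_neg h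
    rw [if_neg h, h2, zero_div]

/-- Quantized Q-learning averages its initial value and the targets at the visits. -/
lemma qLearning_eq_average (c : S → U → ℝ) (β : ℝ) (q : S → Fin M) (Q₀ : Fin M → U → ℝ)
    (ω : ℕ → S × U) (t : ℕ) (y : Fin M) (u : U) :
    (1 + ∑ k ∈ Finset.range t, visit q y u (ω k)) * qLearning c β q Q₀ ω t y u =
      Q₀ y u + ∑ k ∈ Finset.range t, visit q y u (ω k) *
        (c (ω k).1 u + β * ⨅ v, qLearning c β q Q₀ ω k (q (ω (k + 1)).1) v) := by
  induction t with
  | zero => simp [qLearning]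
  | succ t ih =>
    have hS : 0 ≤ ∑ k ∈ Finset.range t, visit q y u (ω k) :=
      Finset.sum_nonneg fun k _ => visit_nonneg q y u _
    rw [Finset.sum_range_succ, Finset.sum_range_succ, ← add_assoc (Q₀ y u), ← ih]
    simp only [qLearning]
    rw [stepSize_eq]
    set s := ∑ k ∈ Finset.range t, visit q y u (ω k)
    have hv : visit q y u (ω t) = 0 ∨ visit q y u (ω t) = 1 := by
      unfold visit; split_ifs <;> simp
    have h2 : (2 : ℝ) + s ≠ 0 := by linarith
    rcases hv with hv | hv
    · rw [hv]; ring
    · rw [hv]; field_simp; ring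

/-- Quantized Q-learning converges along every path along which the visits to each pair have a
positive frequency and the noise averages out. -/
theorem tendsto_qLearning [Fintype U] [Nonempty U] {c : S → U → ℝ} {β : ℝ} (hβ0 : 0 < β)
    (hβ1 : β < 1) {q : S → Fin M} (Q₀ : Fin M → U → ℝ) {ω : ℕ → S × U} {Qstar p : Fin M → U → ℝ}
    (hp : ∀ y u, 0 < p y u)
    (hN : ∀ y u, Tendsto (fun t : ℕ => (t : ℝ)⁻¹ * ∑ k ∈ Finset.range t, visit q y u (ω k)) atTop
      (𝓝 (p y u)))
    (hR : ∀ y u, Tendsto (fun t : ℕ => (t : ℝ)⁻¹ * ∑ k ∈ Finset.range t, visit q y u (ω k) *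
      (c (ω k).1 u + β * ⨅ v, Qstar (q (ω (k + 1)).1) v)) atTop (𝓝 (p y u * Qstar y u)))
    (y : Fin M) (u : U) :
    Tendsto (fun t => qLearning c β q Q₀ ω t y u) atTop (𝓝 (Qstar y u)) := by
  set a : ℕ → Fin M × U → ℝ := fun k i => visit q i.1 i.2 (ω k) with ha_def
  set Δ : ℕ → Fin M × U → ℝ := fun t i => qLearning c β q Q₀ ω t i.1 i.2 - Qstar i.1 i.2
  set R : ℕ → Fin M × U → ℝ := fun t i => ∑ k ∈ Finset.range t, a k i *
    (c (ω k).1 i.2 + β * ⨅ v, Qstar (q (ω (k + 1)).1) v)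
  -- The error that would remain if all targets were computed with `Qstar` instead of the iterates.
  set W : ℕ → Fin M × U → ℝ := fun t i =>
    (Q₀ i.1 i.2 + R t i) / (1 + ∑ k ∈ Finset.range t, a k i) - Qstar i.1 i.2
  have ha : ∀ k i, 0 ≤ a k i := fun k i => visit_nonneg q _ _ _
  have hinv : Tendsto (fun t : ℕ => (t : ℝ)⁻¹) atTop (𝓝 0) := tendsto_inv_atTop_nhds_zero_nat
  have hS : ∀ i, Tendsto (fun t => ∑ k ∈ Finset.range t, a k i) atTop atTop := fun i => by
    -- The number of visits is t times a frequency with a positive limit.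
    have h := tendsto_natCast_atTop_atTop (R := ℝ) |>.atTop_mul_pos (hp i.1 i.2) (hN i.1 i.2)
    refine h.congr' ?_
    filter_upwards [eventually_gt_atTop 0] with t ht
    have ht' : (t : ℝ) ≠ 0 := by exact_mod_cast ht.ne'
    rw [mul_inv_cancel_left₀ ht']
  have hW : ∀ i, Tendsto (fun t => W t i) atTop (𝓝 0) := fun i => by
    have h1 := (hinv.mul_const (Q₀ i.1 i.2)).add (hR i.1 i.2)
    have h2 := hinv.add (hN i.1 i.2)
    rw [zero_mul, zero_add] at h1
    rw [zero_add] at h2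
    have h3 := (h1.div h2 (hp i.1 i.2).ne').sub_const (Qstar i.1 i.2)
    rw [mul_div_cancel_left₀ _ (hp i.1 i.2).ne', sub_self] at h3
    refine h3.congr' ?_
    filter_upwards [eventually_gt_atTop 0] with t ht
    have ht' : (t : ℝ)⁻¹ ≠ 0 := inv_ne_zero (by exact_mod_cast ht.ne')
    have e1 : (t : ℝ)⁻¹ * Q₀ i.1 i.2 + (t : ℝ)⁻¹ * R t i = (t : ℝ)⁻¹ * (Q₀ i.1 i.2 + R t i) := by
      ring
    have e2 : (t : ℝ)⁻¹ + (t : ℝ)⁻¹ * ∑ k ∈ Finset.range t, a k i =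
        (t : ℝ)⁻¹ * (1 + ∑ k ∈ Finset.range t, a k i) := by ring
    change ((t : ℝ)⁻¹ * Q₀ i.1 i.2 + (t : ℝ)⁻¹ * R t i) /
      ((t : ℝ)⁻¹ + (t : ℝ)⁻¹ * ∑ k ∈ Finset.range t, a k i) - Qstar i.1 i.2 = W t i
    rw [e1, e2, mul_div_mul_left _ _ ht']
  have hmain : Tendsto (fun t => ‖Δ t‖) atTop (𝓝 0) := by
    refine tendsto_zero_of_weighted_average hβ0 hβ1 ha hS (fun t i => ?_) hW
    have hSt : 0 ≤ ∑ k ∈ Finset.range t, a k i := Finset.sum_nonneg fun k _ => ha k i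
    have hpos : 0 < 1 + ∑ k ∈ Finset.range t, a k i := by linarith
    have havg := qLearning_eq_average c β q Q₀ ω t i.1 i.2
    -- The effect on the targets of using the iterates; each term is controlled by β times the sup
    -- norm of the error at that time.
    set E := ∑ k ∈ Finset.range t, a k i * (β * ((⨅ v, qLearning c β q Q₀ ω k (q (ω (k + 1)).1) v) -
      ⨅ v, Qstar (q (ω (k + 1)).1) v)) with hE
    have hsplit : Δ t i = W t i + E / (1 + ∑ k ∈ Finset.range t, a k i) := by
      have h1 : qLearning c β q Q₀ ω t i.1 i.2 =
          (Q₀ i.1 i.2 + R t i + E) / (1 + ∑ k ∈ Finset.range t, a k i) := by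
        rw [eq_div_iff hpos.ne', mul_comm, havg, add_assoc, hE, ← Finset.sum_add_distrib]
        congr 1
        refine Finset.sum_congr rfl fun k _ => ?_
        simp only [ha_def]
        ring
      simp only [Δ, W]
      rw [h1]
      ring
    rw [hsplit]
    refine (abs_add_le _ _).trans (add_le_add le_rfl ?_)
    rw [abs_div, abs_of_pos hpos, ← mul_div_assoc]
    refine div_le_div_of_nonneg_right ?_ hpos.le
    rw [Finset.mul_sum]
    refine (Finset.abs_sum_le_sum_abs _ _).trans (Finset.sum_le_sum fun k _ => ?_)
    rw [abs_mul, abs_of_nonneg (ha k i), abs_mul, abs_of_pos hβ0]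
    have h1 : |(⨅ v, qLearning c β q Q₀ ω k (q (ω (k + 1)).1) v) -
        ⨅ v, Qstar (q (ω (k + 1)).1) v| ≤ ‖Δ k‖ :=
      abs_ciInf_sub_ciInf_le fun v => norm_le_pi_norm (Δ k) (q (ω (k + 1)).1, v)
    calc a k i * (β * |_|) ≤ a k i * (β * ‖Δ k‖) :=
          mul_le_mul_of_nonneg_left (mul_le_mul_of_nonneg_left h1 hβ0.le) (ha k i)
      _ = β * (a k i * ‖Δ k‖) := by ring
  have hcoord : Tendsto (fun t => Δ t (y, u)) atTop (𝓝 0) :=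
    squeeze_zero_norm (fun t => norm_le_pi_norm (Δ t) (y, u)) hmain
  have := hcoord.add_const (Qstar y u)
  rw [zero_add] at this
  refine this.congr fun t => ?_
  simp [Δ]

end QLearning

/-! ### The state-action chain under a stationary policy -/

section StateAction

variable {S U : Type*} [MeasurableSpace S] [MeasurableSpace U]

/-- The transition kernel of the state-action process under the stationary policy `η`. -/
noncomputable def stateActionKernel (T : Kernel (S × U) S) (η : Kernel S U) :
    Kernel (S × U) (S × U) :=
  T ⊗ₖ η.comap Prod.snd measurable_snd

variable (T : Kernel (S × U) S) [IsMarkovKernel T] (η : Kernel S U) [IsMarkovKernel η]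

instance : IsMarkovKernel (stateActionKernel T η) := by
  unfold stateActionKernel; infer_instance

instance : IsMarkovKernel (stateKernel T η) := by
  unfold stateKernel; infer_instance

lemma stateActionKernel_apply (z : S × U) : stateActionKernel T η z = T z ⊗ₘ η := by
  ext s hs
  rw [stateActionKernel, Kernel.compProd_apply hs, Measure.compProd_apply hs]
  rfl

instance (ρ : Measure S) [IsProbabilityMeasure ρ] (γ : Policy S U) :
    IsProbabilityMeasure (pathLaw T ρ γ) := by
  unfold pathLaw
  exact inferInstanceAs (IsProbabilityMeasure (Kernel.trajMeasure (X := fun _ => S × U) _ _))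

lemma map_zero_pathLaw (ρ : Measure S) [IsProbabilityMeasure ρ] (γ : Policy S U) :
    (pathLaw T ρ γ).map (fun ω => ω 0) = ρ ⊗ₘ γ.init :=
  map_zero_trajMeasure _ _

lemma isMarkovLaw_pathLaw (ρ : Measure S) [IsProbabilityMeasure ρ] :
    IsMarkovLaw (stateActionKernel T η) (pathLaw T ρ (stationaryPolicy η)) := by
  refine isMarkovLaw_trajMeasure _ _ (fun n h => ?_) _
  ext s hs
  rw [stepKernel, Kernel.compProd_apply hs, stateActionKernel, Kernel.compProd_apply hs]
  rfl

lemma bind_stateActionKernel (ν : Measure (S × U)) [IsFiniteMeasure ν] :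
    ν.bind (stateActionKernel T η) = (ν.bind T) ⊗ₘ η := by
  ext s hs
  rw [Measure.bind_apply hs (Kernel.aemeasurable _), Measure.compProd_apply hs,
    Measure.lintegral_bind T.aemeasurable (Kernel.measurable_kernel_prodMk_left hs).aemeasurable]
  refine lintegral_congr fun z => ?_
  rw [stateActionKernel_apply, Measure.compProd_apply hs]

omit [IsMarkovKernel T] in
lemma bind_stateKernel (π : Measure S) [IsFiniteMeasure π] :
    π.bind (stateKernel T η) = (π ⊗ₘ η).bind T := by
  rw [Measure.compProd_eq_comp_prod, Measure.comp_assoc, stateKernel]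

/-- The unique invariant probability measure of the state-action process. -/
lemma isUniqueInvariant_compProd {π : Measure S} (hπ : IsUniqueInvariant (stateKernel T η) π) :
    IsUniqueInvariant (stateActionKernel T η) (π ⊗ₘ η) := by
  obtain ⟨hprob, hinv, huniq⟩ := hπ
  refine ⟨inferInstance, ?_, fun ν hν hνinv => ?_⟩
  · change (π ⊗ₘ η).bind _ = _
    rw [bind_stateActionKernel, ← bind_stateKernel, hinv.def]
  · have h1 : (ν.bind T) ⊗ₘ η = ν := by rw [← bind_stateActionKernel]; exact hνinv
    have h2 : (ν.bind T) = π := by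
      refine huniq _ inferInstance ?_
      change (ν.bind T).bind _ = _
      rw [bind_stateKernel, h1]
    rw [← h2, h1]

/-- Under a stationary policy, the action is drawn from the current state at all times. -/
lemma exists_map_pathLaw_eq_compProd (ρ : Measure S) [IsProbabilityMeasure ρ] (t : ℕ) :
    ∃ μ : Measure S, IsProbabilityMeasure μ ∧
      (pathLaw T ρ (stationaryPolicy η)).map (fun ω => ω t) = μ ⊗ₘ η := by
  cases t with
  | zero => exact ⟨ρ, inferInstance, map_zero_pathLaw T ρ _⟩
  | succ t =>
    have hp : IsProbabilityMeasure ((pathLaw T ρ (stationaryPolicy η)).map fun ω => ω t) :=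
      Measure.isProbabilityMeasure_map (measurable_pi_apply t).aemeasurable
    refine ⟨((pathLaw T ρ (stationaryPolicy η)).map fun ω => ω t).bind T, inferInstance, ?_⟩
    rw [(isMarkovLaw_pathLaw T η ρ).map_succ t, bind_stateActionKernel]

/-- Almost every state x has a section of A with full η(x)-measure. The process enters the set of
these states, and the action drawn there almost surely lies in the section. Thus the entrance
hypothesis on states suffices for the state-action chain. -/
lemma pathLaw_ae_exists_mem {π : Measure S} [IsProbabilityMeasure π] {ρ : Measure S}
    [IsProbabilityMeasure ρ]
    (hhit : ∀ A : Set S, MeasurableSet A → π A = 1 →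
      ∀ᵐ ω ∂(pathLaw T ρ (stationaryPolicy η)), ∃ t, (ω t).1 ∈ A)
    {A : Set (S × U)} (hA : MeasurableSet A) (hA1 : (π ⊗ₘ η) A = 1) :
    ∀ᵐ ω ∂(pathLaw T ρ (stationaryPolicy η)), ∃ t, ω t ∈ A := by
  set A' : Set S := {x | η x (Prod.mk x ⁻¹' Aᶜ) = 0}
  have hm : Measurable fun x => η x (Prod.mk x ⁻¹' Aᶜ) :=
    Kernel.measurable_kernel_prodMk_left hA.compl
  have hA' : MeasurableSet A' := hm (measurableSet_singleton 0)
  have hA'1 : π A' = 1 := by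
    have h0 := (prob_compl_eq_zero_iff hA).2 hA1
    rw [Measure.compProd_apply hA.compl, lintegral_eq_zero_iff hm] at h0
    exact (prob_compl_eq_zero_iff hA').1 h0
  have hstep : ∀ t, ∀ᵐ ω ∂(pathLaw T ρ (stationaryPolicy η)), (ω t).1 ∈ A' → ω t ∈ A := fun t => by
    obtain ⟨μ, hμ, hlaw⟩ := exists_map_pathLaw_eq_compProd T η ρ t
    have hB : MeasurableSet (Prod.fst ⁻¹' A' ∩ Aᶜ : Set (S × U)) :=
      (measurable_fst hA').inter hA.compl
    have h0 : (μ ⊗ₘ η) (Prod.fst ⁻¹' A' ∩ Aᶜ) = 0 := by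
      rw [Measure.compProd_apply hB]
      refine (lintegral_congr fun x => ?_).trans lintegral_zero
      by_cases hx : x ∈ A'
      · exact measure_mono_null (fun u hu => hu.2) hx
      · exact measure_mono_null (fun u hu => hx hu.1) measure_empty
    rw [← hlaw, Measure.map_apply (measurable_pi_apply t) hB] at h0
    refine measure_mono_null (fun ω hω => ?_) h0
    have h3 : ¬((ω t).1 ∈ A' → ω t ∈ A) := hω
    push Not at h3
    exact h3
  filter_upwards [hhit A' hA' hA'1, ae_all_iff.2 hstep] with ω ⟨t, ht⟩ h
  exact ⟨t, h t ht⟩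

end StateAction

/-! ### The finite model -/

section FiniteModel

variable {S U : Type*} [MeasurableSpace S] [MeasurableSpace U] {M : ℕ}

/-- The cost of the action `u` in the state `x`, followed by the discounted terminal cost `h`. -/
noncomputable def qValue (T : Kernel (S × U) S) (c : S → U → ℝ) (β : ℝ) (h : S → ℝ) (x : S)
    (u : U) : ℝ :=
  c x u + β * ∫ x', h x' ∂(T (x, u))

variable {T : Kernel (S × U) S} [IsMarkovKernel T] {c : S → U → ℝ} {β : ℝ} {q : S → Fin M}

omit [IsMarkovKernel T] in
lemma measurable_integral_kernel {h : S → ℝ} (hh : Measurable h) (u : U) :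
    Measurable fun x => ∫ x', h x' ∂(T (x, u)) := by
  have h1 : StronglyMeasurable fun z : S × U => ∫ x', h x' ∂(T z) :=
    StronglyMeasurable.integral_kernel hh.stronglyMeasurable
  exact h1.measurable.comp measurable_prodMk_right

omit [IsMarkovKernel T] in
lemma measurable_qValue (hc : ∀ u, Measurable fun x => c x u) {h : S → ℝ} (hh : Measurable h)
    (u : U) : Measurable fun x => qValue T c β h x u :=
  (hc u).add ((measurable_integral_kernel hh u).const_mul β)

omit [IsMarkovKernel T] in
lemma abs_integral_le_of_abs_le {α : Type*} [MeasurableSpace α] {μ : Measure α}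
    [IsProbabilityMeasure μ] {h : α → ℝ} {B : ℝ} (hB : ∀ x, |h x| ≤ B) : |∫ x, h x ∂μ| ≤ B := by
  have := norm_integral_le_of_norm_le_const (μ := μ) (f := h) (C := B)
    (Eventually.of_forall hB)
  simpa using this

lemma abs_qValue_le (hβ0 : 0 ≤ β) {L B : ℝ} (hL : ∀ x u, |c x u| ≤ L) {h : S → ℝ}
    (hB : ∀ x, |h x| ≤ B) (x : S) (u : U) : |qValue T c β h x u| ≤ L + β * B := by
  refine (abs_add_le _ _).trans (add_le_add (hL x u) ?_)
  rw [abs_mul, abs_of_nonneg hβ0]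
  exact mul_le_mul_of_nonneg_left (abs_integral_le_of_abs_le hB) hβ0

lemma measurableSet_bin (hq : Measurable q) (i : Fin M) : MeasurableSet (bin q i) :=
  hq (measurableSet_singleton i)

lemma isProbabilityMeasure_binMeasure {π : Measure S} [IsFiniteMeasure π] {i : Fin M}
    (h : 0 < π (bin q i)) : IsProbabilityMeasure (binMeasure q π i) :=
  cond_isProbabilityMeasure h.ne'

lemma integral_comp_quantizer (hq : Measurable q) (μ : Measure S) [IsFiniteMeasure μ]
    (V : Fin M → ℝ) : ∫ x, V (q x) ∂μ = ∑ y, μ.real (bin q y) * V y := by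
  have h1 : ∀ x, V (q x) = ∑ y, (bin q y).indicator (fun _ => V y) x := fun x => by
    classical
    simp [bin, Set.indicator_apply]
  simp_rw [h1]
  rw [integral_finsetSum _ fun y _ => (integrable_const _).indicator (measurableSet_bin hq y)]
  refine Finset.sum_congr rfl fun y _ => ?_
  rw [integral_indicator (measurableSet_bin hq y), setIntegral_const, smul_eq_mul]

/-- The optimality equation of the finite model, as an average over the bins. -/
lemma isFiniteModelQ_iff (hc : ∀ u, Measurable fun x => c x u)
    (hcb : ∃ L : ℝ, ∀ x u, |c x u| ≤ L) (hq : Measurable q) {π : Measure S} [IsFiniteMeasure π]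
    (hπpos : ∀ i, 0 < π (bin q i)) (Q : Fin M → U → ℝ) :
    IsFiniteModelQ T c β q π Q ↔ ∀ y u, Q y u =
      ∫ x, qValue T c β (fun x => ⨅ v, Q (q x) v) x u ∂(binMeasure q π y) := by
  refine forall_congr' fun y => forall_congr' fun u => ?_
  have hprob := isProbabilityMeasure_binMeasure (hπpos y)
  obtain ⟨L, hL⟩ := hcb
  have hic : Integrable (fun x => c x u) (binMeasure q π y) :=
    Integrable.of_bound (hc u).aestronglyMeasurable L (Eventually.of_forall fun x => hL x u)
  have hTm : ∀ y', Measurable fun x => (T (x, u)).real (bin q y') := fun y' =>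
    (T.measurable_coe (measurableSet_bin hq y')).ennreal_toReal.comp measurable_prodMk_right
  have hTi : ∀ y', Integrable (fun x => (T (x, u)).real (bin q y')) (binMeasure q π y) := fun y' =>
    Integrable.of_bound (hTm y').aestronglyMeasurable 1 (Eventually.of_forall fun x => by
      rw [Real.norm_of_nonneg measureReal_nonneg]; exact measureReal_le_one)
  have h1 : ∫ x, qValue T c β (fun x => ⨅ v, Q (q x) v) x u ∂(binMeasure q π y) =
      finiteCost c q π y u + β * ∑ y', finiteTransition T q π y' y u * ⨅ v, Q y' v := by
    simp only [qValue, finiteCost, finiteTransition]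
    simp_rw [integral_comp_quantizer hq _ fun y => ⨅ v, Q y v]
    rw [integral_add hic ((integrable_finsetSum _ fun y' _ =>
        (hTi y').mul_const _).const_mul β), integral_const_mul,
      integral_finsetSum _ fun y' _ => (hTi y').mul_const _]
    simp_rw [integral_mul_const]
  rw [h1]

omit [MeasurableSpace S] [MeasurableSpace U] in
lemma visit_eq_mul [DecidableEq U] (y : Fin M) (u : U) (x : S) (v : U) :
    visit q y u (x, v) = (bin q y).indicator 1 x * if v = u then 1 else 0 := by
  classical
  unfold visit
  by_cases h : q x = y
  · have : x ∈ bin q y := h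
    by_cases h' : v = u <;> simp [h, h', this]
  · have : x ∉ bin q y := h
    simp [h, this]

lemma measurable_visit [MeasurableSingletonClass U] (hq : Measurable q) (y : Fin M) (u : U) :
    Measurable (visit q y u) := by
  classical
  exact Measurable.ite ((measurableSet_bin hq y).prod (measurableSet_singleton u))
    measurable_const measurable_const

omit [MeasurableSpace S] [MeasurableSpace U] in
lemma abs_visit_le (y : Fin M) (u : U) (z : S × U) : |visit q y u z| ≤ 1 := by
  classical
  unfold visit; split_ifs <;> simp

/-- Averages over the visits to `(y, u)`, when the randomized policy is constant on the bins. -/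
lemma integral_visit_mul [MeasurableSingletonClass U] (hq : Measurable q)
    {η : Kernel S U} [IsMarkovKernel η] {π : Measure S} [IsProbabilityMeasure π]
    (hπpos : ∀ i, 0 < π (bin q i)) (y : Fin M) (u : U) {e : ℝ}
    (he : ∀ x ∈ bin q y, (η x).real {u} = e) {G : S → ℝ} (hG : Measurable G) {B : ℝ}
    (hB : ∀ x, |G x| ≤ B) :
    ∫ z, visit q y u z * G z.1 ∂(π ⊗ₘ η) =
      π.real (bin q y) * e * ∫ x, G x ∂(binMeasure q π y) := by
  classical
  have hint : Integrable (fun z : S × U => visit q y u z * G z.1) (π ⊗ₘ η) := by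
    refine Integrable.of_bound ((measurable_visit hq y u).mul
      (hG.comp measurable_fst)).aestronglyMeasurable B (Eventually.of_forall fun z => ?_)
    rw [Real.norm_eq_abs, abs_mul]
    calc |visit q y u z| * |G z.1| ≤ 1 * |G z.1| :=
          mul_le_mul_of_nonneg_right (abs_visit_le y u z) (abs_nonneg _)
      _ ≤ B := by rw [one_mul]; exact hB _
  have hpos : π.real (bin q y) ≠ 0 := (ENNReal.toReal_pos (hπpos y).ne' (measure_ne_top _ _)).ne'
  rw [Measure.integral_compProd hint, binMeasure, ProbabilityTheory.cond, integral_smul_measure,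
    ← integral_indicator (measurableSet_bin hq y), ENNReal.toReal_inv, smul_eq_mul,
    ← measureReal_def]
  have h1 : ∀ x, ∫ v, visit q y u (x, v) * G x ∂(η x) = e * (bin q y).indicator G x := fun x => by
    have h2 : ∀ v, visit q y u (x, v) * G x =
        (bin q y).indicator G x * ({u} : Set U).indicator 1 v := fun v => by
      rw [visit_eq_mul]
      by_cases hx : x ∈ bin q y <;> by_cases hv : v = u <;> simp [hx, hv]
    simp_rw [h2]
    rw [integral_const_mul, integral_indicator_one (measurableSet_singleton u)]
    by_cases hx : x ∈ bin q y
    · rw [he x hx, mul_comm]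
    · simp [hx]
  simp only
  simp_rw [h1]
  rw [integral_const_mul]
  field_simp

/-- Quantized Q-learning under a policy which is constant on the bins converges to the optimal
`Q`-function of the finite model. -/
theorem ae_tendsto_qLearning [Fintype U] [Nonempty U] [MeasurableSingletonClass U]
    (hc : ∀ u, Measurable fun x => c x u)
    (hcb : ∃ L : ℝ, ∀ x u, |c x u| ≤ L) (hβ0 : 0 < β) (hβ1 : β < 1) (hq : Measurable q)
    {η : Kernel S U} [IsMarkovKernel η] {π : Measure S}
    (hπ : IsUniqueInvariant (stateKernel T η) π) (hπpos : ∀ i, 0 < π (bin q i))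
    {Qstar : Fin M → U → ℝ} (hQstar : IsFiniteModelQ T c β q π Qstar)
    {ρ : Measure S} [IsProbabilityMeasure ρ] (hη : ∀ x x', q x = q x' → η x = η x')
    (hhit : ∀ A : Set S, MeasurableSet A → π A = 1 →
      ∀ᵐ ω ∂(pathLaw T ρ (stationaryPolicy η)), ∃ t, (ω t).1 ∈ A)
    (hio : ∀ᵐ ω ∂(pathLaw T ρ (stationaryPolicy η)),
      ∀ y u, ∃ᶠ t in atTop, q (ω t).1 = y ∧ (ω t).2 = u) (Q₀ : Fin M → U → ℝ) :
    ∀ᵐ ω ∂(pathLaw T ρ (stationaryPolicy η)),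
      ∀ y u, Tendsto (fun t => qLearning c β q Q₀ ω t y u) atTop (𝓝 (Qstar y u)) := by
  have hprob := hπ.1
  set P := pathLaw T ρ (stationaryPolicy η) with hP
  set K := stateActionKernel T η
  have hM : IsMarkovLaw K P := isMarkovLaw_pathLaw T η ρ
  have hν := isUniqueInvariant_compProd T η hπ
  have hhit' : ∀ A : Set (S × U), MeasurableSet A → (π ⊗ₘ η) A = 1 → ∀ᵐ ω ∂P, ∃ t, ω t ∈ A :=
    fun A hA hA1 => pathLaw_ae_exists_mem T η hhit hA hA1
  have hne : ∀ y, ∃ x, x ∈ bin q y := fun y =>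
    nonempty_of_measure_ne_zero (hπpos y).ne'
  choose s hs using hne
  set e : Fin M → U → ℝ := fun y u => (η (s y)).real {u}
  have he : ∀ y u, ∀ x ∈ bin q y, (η x).real {u} = e y u := fun y u x hx => by
    have h1 : q x = q (s y) := Eq.trans hx (hs y).symm
    simp only [e, hη x (s y) h1]
  -- If the policy never chose u on the bin y, the pair (y,u) would almost surely never be visited,
  -- contrary to the assumption of infinitely many visits.
  have hepos : ∀ y u, 0 < e y u := fun y u => by
    refine lt_of_le_of_ne measureReal_nonneg fun h0 => ?_
    have hnull : ∀ t, ∀ᵐ ω ∂P, ¬(q (ω t).1 = y ∧ (ω t).2 = u) := fun t => by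
      obtain ⟨μ, hμ, hlaw⟩ := exists_map_pathLaw_eq_compProd T η ρ t
      have hB := (measurableSet_bin hq y).prod (measurableSet_singleton u)
      have hz : (μ ⊗ₘ η) (bin q y ×ˢ {u}) = 0 := by
        rw [Measure.compProd_apply_prod (measurableSet_bin hq y) (measurableSet_singleton u)]
        refine (setLIntegral_congr_fun (g := fun _ => 0) (measurableSet_bin hq y)
          fun x hx => ?_).trans (by simp)
        have h1 := he y u x hx
        rw [← h0, measureReal_eq_zero_iff] at h1
        exact h1
      rw [← hlaw, Measure.map_apply (measurable_pi_apply t) hB] at hz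
      refine measure_mono_null (fun ω hω => ?_) hz
      exact not_not.1 hω
    obtain ⟨ω, h1, h2⟩ := (hio.and (ae_all_iff.2 hnull)).exists
    obtain ⟨t, ht⟩ := (h1 y u).exists
    exact h2 t ht
  set V : S → ℝ := fun x => ⨅ v, Qstar (q x) v
  have hV : Measurable V := (measurable_of_finite fun y => ⨅ v, Qstar y v).comp hq
  obtain ⟨B, hVB⟩ : ∃ B, ∀ x, |V x| ≤ B := by
    obtain ⟨B, hB⟩ := (Set.finite_range fun y => |⨅ v, Qstar y v|).bddAbove
    exact ⟨B, fun x => hB ⟨q x, rfl⟩⟩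
  have hQeq := (isFiniteModelQ_iff hc hcb hq hπpos Qstar).1 hQstar
  obtain ⟨L, hL⟩ := hcb
  set p : Fin M → U → ℝ := fun y u => π.real (bin q y) * e y u
  have hp : ∀ y u, 0 < p y u := fun y u =>
    mul_pos (ENNReal.toReal_pos (hπpos y).ne' (measure_ne_top _ _)) (hepos y u)
  have hN : ∀ y u, ∀ᵐ ω ∂P, Tendsto
      (fun t : ℕ => (t : ℝ)⁻¹ * ∑ k ∈ Finset.range t, visit q y u (ω k)) atTop (𝓝 (p y u)) := by
    intro y u
    have h := hM.ae_tendsto_average hν hhit' (f := fun w => visit q y u w.1)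
      ((measurable_visit hq y u).comp measurable_fst) (B := 1) fun w => abs_visit_le y u w.1
    have hi : Integrable (fun w : (S × U) × (S × U) => visit q y u w.1) ((π ⊗ₘ η) ⊗ₘ K) :=
      Integrable.of_bound ((measurable_visit hq y u).comp measurable_fst).aestronglyMeasurable 1
        (Eventually.of_forall fun w => abs_visit_le y u w.1)
    have hprobm := isProbabilityMeasure_binMeasure (hπpos y)
    have h1 : ∫ w, visit q y u w.1 ∂((π ⊗ₘ η) ⊗ₘ K) = p y u := by
      rw [Measure.integral_compProd hi]
      have h2 := integral_visit_mul hq hπpos y u (he y u) (G := fun _ => 1) measurable_const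
        (B := 1) (by simp)
      simpa using h2
    rwa [h1] at h
  have hR : ∀ y u, ∀ᵐ ω ∂P, Tendsto (fun t : ℕ => (t : ℝ)⁻¹ * ∑ k ∈ Finset.range t,
      visit q y u (ω k) * (c (ω k).1 u + β * V (ω (k + 1)).1)) atTop
      (𝓝 (p y u * Qstar y u)) := by
    intro y u
    set f : (S × U) × (S × U) → ℝ := fun w => visit q y u w.1 * (c w.1.1 u + β * V w.2.1)
    have hfm : Measurable f := ((measurable_visit hq y u).comp measurable_fst).mul
      (((hc u).comp (measurable_fst.comp measurable_fst)).add
        ((hV.comp (measurable_fst.comp measurable_snd)).const_mul β))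
    have hfb : ∀ w, |f w| ≤ L + β * B := fun w => by
      have h1 : |c w.1.1 u + β * V w.2.1| ≤ L + β * B := by
        refine (abs_add_le _ _).trans (add_le_add (hL _ _) ?_)
        rw [abs_mul, abs_of_pos hβ0]
        exact mul_le_mul_of_nonneg_left (hVB _) hβ0.le
      simp only [f, abs_mul]
      calc |visit q y u w.1| * |c w.1.1 u + β * V w.2.1|
          ≤ 1 * |c w.1.1 u + β * V w.2.1| :=
            mul_le_mul_of_nonneg_right (abs_visit_le y u w.1) (abs_nonneg _)
        _ ≤ L + β * B := by rw [one_mul]; exact h1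
    have h := hM.ae_tendsto_average hν hhit' hfm hfb
    have hi : Integrable f ((π ⊗ₘ η) ⊗ₘ K) :=
      Integrable.of_bound hfm.aestronglyMeasurable _ (Eventually.of_forall hfb)
    -- Integrating out the next pair turns the target into the `qValue` at the current state;
    -- integrating over the visits then gives their frequency times the bin average, which is `Qstar
    -- y u` by the optimality equation.
    have h1 : ∫ w, f w ∂((π ⊗ₘ η) ⊗ₘ K) = p y u * Qstar y u := by
      rw [Measure.integral_compProd hi, hQeq y u,
        ← integral_visit_mul hq hπpos y u (he y u) (measurable_qValue hc hV u)
          (abs_qValue_le hβ0.le hL hVB · u)]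
      refine integral_congr_ae (Eventually.of_forall fun z => ?_)
      obtain ⟨x, v⟩ := z
      simp only [f]
      rw [integral_const_mul]
      by_cases hv : v = u
      · subst hv
        congr 1
        have hVi : ∀ z, Integrable (fun w : S × U => V w.1) (K z) := fun z =>
          Integrable.of_bound (hV.comp measurable_fst).aestronglyMeasurable B
            (Eventually.of_forall fun w => hVB _)
        have h2 : ∫ w, V w.1 ∂(K (x, v)) = ∫ x', V x' ∂(T (x, v)) := by
          have h3 := hVi (x, v)
          simp only [K, stateActionKernel_apply] at h3 ⊢
          rw [Measure.integral_compProd h3]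
          simp
        rw [integral_add (integrable_const _) ((hVi _).const_mul β), integral_const_mul, h2]
        simp [qValue]
      · have : visit q y u (x, v) = 0 := if_neg fun h => hv h.2
        rw [this, zero_mul, zero_mul]
    rwa [h1] at h
  filter_upwards [ae_all_iff.2 fun y => ae_all_iff.2 fun u => hN y u,
    ae_all_iff.2 fun y => ae_all_iff.2 fun u => hR y u] with ω h1 h2 y u
  exact tendsto_qLearning hβ0 hβ1 Q₀ hp h1 h2 y u

end FiniteModel

/-! ### The optimality equation and the verification theorem -/

section DynamicProgramming

variable {S U : Type*} [MeasurableSpace S] [MeasurableSpace U]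

/-- Choosing the first suitable element in an enumeration of U makes the selection measurable. -/
lemma exists_measurable_selection [Countable U] [Nonempty U] (A : U → Set S)
    (hA : ∀ u, MeasurableSet (A u)) (hcov : ∀ x, ∃ u, x ∈ A u) :
    ∃ f : S → U, Measurable f ∧ ∀ x, x ∈ A (f x) := by
  classical
  obtain ⟨e, he⟩ := exists_surjective_nat U
  have h : ∀ x, ∃ n, x ∈ A (e n) := fun x => by
    obtain ⟨u, hu⟩ := hcov x
    obtain ⟨n, rfl⟩ := he u
    exact ⟨n, hu⟩
  exact ⟨fun x => e (Nat.find (h x)),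
    Measurable.find (f := fun n _ => e n) (p := fun n x => x ∈ A (e n)) (fun n => measurable_const) (fun n => hA (e n)) h,
    fun x => Nat.find_spec (h x)⟩

variable {T : Kernel (S × U) S} [IsMarkovKernel T] {c : S → U → ℝ} {β : ℝ}

lemma integrable_of_abs_le {α : Type*} [MeasurableSpace α] {μ : Measure α} [IsFiniteMeasure μ]
    {h : α → ℝ} (hh : Measurable h) {B : ℝ} (hB : ∀ x, |h x| ≤ B) : Integrable h μ :=
  Integrable.of_bound hh.aestronglyMeasurable B (Eventually.of_forall hB)

lemma abs_qValue_sub_le (hβ0 : 0 ≤ β) {h h' : S → ℝ} (hh : Measurable h) (hh' : Measurable h')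
    {B B' : ℝ} (hB : ∀ x, |h x| ≤ B) (hB' : ∀ x, |h' x| ≤ B') {D : ℝ}
    (hD : ∀ x, |h x - h' x| ≤ D) (x : S) (u : U) :
    |qValue T c β h x u - qValue T c β h' x u| ≤ β * D := by
  have h1 : qValue T c β h x u - qValue T c β h' x u = β * ∫ x', (h x' - h' x') ∂(T (x, u)) := by
    rw [integral_sub (integrable_of_abs_le hh hB) (integrable_of_abs_le hh' hB')]
    simp only [qValue]
    ring
  rw [h1, abs_mul, abs_of_nonneg hβ0]
  exact mul_le_mul_of_nonneg_left (abs_integral_le_of_abs_le hD) hβ0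

omit [MeasurableSpace U] in
lemma abs_ciInf_le [Finite U] [Nonempty U] {f : U → ℝ} {B : ℝ} (h : ∀ v, |f v| ≤ B) :
    |⨅ v, f v| ≤ B := by
  obtain ⟨v, hv⟩ := exists_eq_ciInf_of_finite (f := f)
  rw [← hv]
  exact h v

/-- The optimality equation has a bounded measurable solution. -/
theorem exists_bellman_solution [Finite U] [Nonempty U] (hc : ∀ u, Measurable fun x => c x u)
    {L : ℝ} (hL : ∀ x u, |c x u| ≤ L) (hβ0 : 0 < β) (hβ1 : β < 1) :
    ∃ V : S → ℝ, Measurable V ∧ (∃ B, ∀ x, |V x| ≤ B) ∧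
      ∀ x, V x = ⨅ v, qValue T c β V x v := by
  set F : (S → ℝ) → S → ℝ := fun h x => ⨅ v, qValue T c β h x v
  set V : ℕ → S → ℝ := fun n => F^[n] 0
  have hsucc : ∀ n, V (n + 1) = F (V n) := fun n => Function.iterate_succ_apply' F n 0
  have hm : ∀ n, Measurable (V n) := fun n => by
    induction n with
    | zero => exact measurable_const
    | succ n ih => rw [hsucc]; exact Measurable.iInf fun v => measurable_qValue hc ih v
  have hβ : 0 < 1 - β := by linarith
  have hbd : ∀ n x, |V n x| ≤ L / (1 - β) := fun n => by
    induction n with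
    | zero =>
      intro x
      obtain ⟨u⟩ := ‹Nonempty U›
      have : 0 ≤ L := (abs_nonneg _).trans (hL x u)
      simpa [V] using div_nonneg this hβ.le
    | succ n ih =>
      intro x
      rw [hsucc]
      refine (abs_ciInf_le fun v => abs_qValue_le hβ0.le hL ih x v).trans (le_of_eq ?_)
      field_simp
      ring
  -- Uniform geometric increments make the value iteration from 0 converge uniformly, so that the
  -- limit is measurable, bounded and a fixed point.
  have hstep : ∀ n x, |V n x - V (n + 1) x| ≤ L * β ^ n := fun n => by
    induction n with
    | zero =>
      intro x
      rw [hsucc]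
      have h0 : V 0 = 0 := rfl
      rw [h0, Pi.zero_apply, zero_sub, abs_neg, pow_zero, mul_one]
      refine abs_ciInf_le fun v => ?_
      simpa [qValue] using hL x v
    | succ n ih =>
      intro x
      have h1 : V (n + 1) x - V (n + 1 + 1) x = F (V n) x - F (V (n + 1)) x :=
        congrArg₂ (· - ·) (congrFun (hsucc n) x) (congrFun (hsucc (n + 1)) x)
      rw [h1]
      refine (abs_ciInf_sub_ciInf_le fun v => abs_qValue_sub_le (T := T) (c := c) hβ0.le (hm n)
        (hm (n + 1)) (hbd n) (hbd (n + 1)) ih x v).trans (le_of_eq ?_)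
      ring
  have hconv : ∀ x, ∃ l, Tendsto (fun n => V n x) atTop (𝓝 l) := fun x =>
    cauchySeq_tendsto_of_complete (cauchySeq_of_le_geometric β L hβ1 fun n => hstep n x)
  choose W hW using hconv
  have hWm : Measurable W := measurable_of_tendsto_metrizable hm (tendsto_pi_nhds.2 hW)
  have hWb : ∀ x, |W x| ≤ L / (1 - β) := fun x =>
    le_of_tendsto' (hW x).abs fun n => hbd n x
  have hrate : ∀ n x, |V n x - W x| ≤ L * β ^ n / (1 - β) := fun n x =>
    dist_le_of_le_geometric_of_tendsto β L hβ1 (fun n => hstep n x) (hW x) n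
  refine ⟨W, hWm, ⟨_, hWb⟩, fun x => ?_⟩
  refine tendsto_nhds_unique ((tendsto_add_atTop_iff_nat 1).2 (hW x)) ?_
  have hz : Tendsto (fun n : ℕ => β * (L * β ^ n / (1 - β))) atTop (𝓝 (β * (L * 0 / (1 - β)))) :=
    (((tendsto_pow_atTop_nhds_zero_of_lt_one hβ0.le hβ1).const_mul L).div_const _).const_mul β
  rw [mul_zero, zero_div, mul_zero] at hz
  refine tendsto_iff_norm_sub_tendsto_zero.2 (squeeze_zero (fun n => norm_nonneg _) (fun n => ?_) hz)
  rw [hsucc]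
  exact abs_ciInf_sub_ciInf_le fun v => abs_qValue_sub_le (T := T) (c := c) hβ0.le (hm n) hWm
    (hbd n) hWb (hrate n) x v

/-- The law of the next state. -/
lemma map_succ_fst_pathLaw (ρ : Measure S) [IsProbabilityMeasure ρ] (γ : Policy S U) (t : ℕ) :
    (pathLaw T ρ γ).map (fun ω => (ω (t + 1)).1) =
      ((pathLaw T ρ γ).map fun ω => ω t).bind T := by
  have h := Kernel.map_frestrictLe_trajMeasure_compProd_eq_map_trajMeasure
    (X := fun _ => S × U) (μ₀ := ρ ⊗ₘ γ.init) (κ := stepKernel T γ) (a := t)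
  ext B hB
  have hB' : MeasurableSet (Prod.fst ⁻¹' B : Set (S × U)) := measurable_fst hB
  have h1 := congrArg (fun m => m (Set.univ ×ˢ (Prod.fst ⁻¹' B))) h
  have hm : Measurable fun ω : ℕ → S × U => (history t ω, ω (t + 1)) :=
    (measurable_history t).prodMk (measurable_pi_apply _)
  rw [Measure.map_apply hm (MeasurableSet.univ.prod hB'),
    Measure.compProd_apply_prod MeasurableSet.univ hB', Measure.restrict_univ,
    lintegral_map ((stepKernel T γ t).measurable_coe hB') (measurable_history t)] at h1
  have hm1 : Measurable fun ω : ℕ → S × U => (ω (t + 1)).1 :=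
    measurable_fst.comp (measurable_pi_apply _)
  rw [Measure.map_apply hm1 hB, Measure.bind_apply hB T.aemeasurable,
    lintegral_map (T.measurable_coe hB) (measurable_pi_apply t)]
  have hset : (fun ω : ℕ → S × U => (ω (t + 1)).1) ⁻¹' B =
      (fun ω : ℕ → S × U => (history t ω, ω (t + 1))) ⁻¹' (Set.univ ×ˢ (Prod.fst ⁻¹' B)) := by
    ext ω; simp
  rw [hset]
  refine h1.symm.trans (lintegral_congr fun ω => ?_)
  rw [stepKernel, Kernel.compProd_apply hB']
  have h2 : ∀ x, (γ.next t) (history t ω, x) (Prod.mk x ⁻¹' (Prod.fst ⁻¹' B)) =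
      B.indicator 1 x := fun x => by
    by_cases hx : x ∈ B
    · have : (Prod.mk x ⁻¹' (Prod.fst ⁻¹' B) : Set U) = Set.univ := by ext; simp [hx]
      rw [this, measure_univ, Set.indicator_of_mem hx]; rfl
    · have : (Prod.mk x ⁻¹' (Prod.fst ⁻¹' B) : Set U) = ∅ := by ext; simp [hx]
      rw [this, measure_empty, Set.indicator_of_notMem hx]
  refine (lintegral_congr h2).trans ?_
  rw [lintegral_indicator_one hB]
  rfl

lemma integral_succ_fst_pathLaw (ρ : Measure S) [IsProbabilityMeasure ρ] (γ : Policy S U) (t : ℕ)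
    {h : S → ℝ} (hh : Measurable h) {B : ℝ} (hB : ∀ x, |h x| ≤ B) :
    ∫ ω, h (ω (t + 1)).1 ∂(pathLaw T ρ γ) =
      ∫ ω, ∫ x', h x' ∂(T (ω t)) ∂(pathLaw T ρ γ) := by
  have hm1 : Measurable fun ω : ℕ → S × U => (ω (t + 1)).1 :=
    measurable_fst.comp (measurable_pi_apply _)
  have hp : IsProbabilityMeasure ((pathLaw T ρ γ).map fun ω => ω t) :=
    Measure.isProbabilityMeasure_map (measurable_pi_apply t).aemeasurable
  have hi : Integrable (fun z : (S × U) × S => h z.2)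
      ((pathLaw T ρ γ).map (fun ω => ω t) ⊗ₘ T) :=
    integrable_of_abs_le (hh.comp measurable_snd) fun z => hB z.2
  rw [← integral_map hm1.aemeasurable hh.aestronglyMeasurable, map_succ_fst_pathLaw,
    ← Measure.snd_compProd, Measure.snd,
    integral_map measurable_snd.aemeasurable hh.aestronglyMeasurable,
    Measure.integral_compProd hi]
  exact integral_map (measurable_pi_apply t).aemeasurable
    (StronglyMeasurable.integral_kernel hh.stronglyMeasurable).aestronglyMeasurable

lemma integral_zero_fst_pathLaw (x₀ : S) (γ : Policy S U) {h : S → ℝ} (hh : Measurable h) :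
    ∫ ω, h (ω 0).1 ∂(pathLaw T (Measure.dirac x₀) γ) = h x₀ := by
  have h1 : (pathLaw T (Measure.dirac x₀) γ).map (fun ω => (ω 0).1) = Measure.dirac x₀ := by
    have : (fun ω : ℕ → S × U => (ω 0).1) = Prod.fst ∘ fun ω => ω 0 := rfl
    rw [this, ← Measure.map_map measurable_fst (measurable_pi_apply 0), map_zero_pathLaw]
    exact Measure.fst_compProd _ _
  have hm : Measurable fun ω : ℕ → S × U => (ω 0).1 := measurable_fst.comp (measurable_pi_apply 0)
  rw [← integral_map hm.aemeasurable hh.aestronglyMeasurable, h1,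
    integral_dirac' _ _ hh.stronglyMeasurable]

lemma measurable_cost [Countable U] [MeasurableSingletonClass U]
    (hc : ∀ u, Measurable fun x => c x u) : Measurable fun z : S × U => c z.1 z.2 :=
  measurable_from_prod_countable_left hc

/-- The discounted cost as the limit of the finite-horizon costs with a bounded terminal cost. -/
lemma tendsto_discountedCost [Countable U] [MeasurableSingletonClass U]
    (hc : ∀ u, Measurable fun x => c x u) {L : ℝ} (hL : ∀ x u, |c x u| ≤ L) (hβ0 : 0 < β)
    (hβ1 : β < 1) {V : S → ℝ} {B : ℝ} (hVB : ∀ x, |V x| ≤ B) (x₀ : S)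
    (γ : AdmissiblePolicy S U) :
    Tendsto (fun n : ℕ => (∑ t ∈ Finset.range n,
        β ^ t * ∫ ω, c (ω t).1 (ω t).2 ∂(pathLaw T (Measure.dirac x₀) γ.toPolicy)) +
        β ^ n * ∫ ω, V (ω n).1 ∂(pathLaw T (Measure.dirac x₀) γ.toPolicy)) atTop
      (𝓝 (discountedCost T c β x₀ γ)) := by
  set P := pathLaw T (Measure.dirac x₀) γ.toPolicy with hP
  have hcm := measurable_cost hc
  have hpow := tendsto_pow_atTop_nhds_zero_of_lt_one hβ0.le hβ1
  have hi : ∀ t : ℕ, Integrable (fun ω : ℕ → S × U => β ^ t * c (ω t).1 (ω t).2) P := fun t =>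
    (integrable_of_abs_le (hcm.comp (measurable_pi_apply t)) fun ω => hL _ _).const_mul _
  have hs : Summable fun t : ℕ => ∫ ω, ‖β ^ t * c (ω t).1 (ω t).2‖ ∂P := by
    refine Summable.of_nonneg_of_le (fun t => integral_nonneg fun ω => norm_nonneg _)
      (fun t => ?_) ((summable_geometric_of_lt_one hβ0.le hβ1).mul_right L)
    refine (le_abs_self _).trans (abs_integral_le_of_abs_le fun ω => ?_)
    rw [abs_norm, Real.norm_eq_abs, abs_mul, abs_of_nonneg (pow_nonneg hβ0.le t)]
    exact mul_le_mul_of_nonneg_left (hL _ _) (pow_nonneg hβ0.le t)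
  have h1 := (hasSum_integral_of_summable_integral_norm hi hs).tendsto_sum_nat
  have h2 : Tendsto (fun n : ℕ => β ^ n * ∫ ω, V (ω n).1 ∂P) atTop (𝓝 0) := by
    have hz := hpow.mul_const B
    rw [zero_mul] at hz
    refine squeeze_zero_norm (fun n => ?_) hz
    rw [norm_mul, Real.norm_of_nonneg (pow_nonneg hβ0.le n)]
    exact mul_le_mul_of_nonneg_left (abs_integral_le_of_abs_le fun ω => hVB _)
      (pow_nonneg hβ0.le n)
  have h3 := h1.add h2
  rw [add_zero] at h3
  simp only [integral_const_mul] at h3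
  exact h3

lemma integral_qValue_pathLaw [Countable U] [MeasurableSingletonClass U]
    (hc : ∀ u, Measurable fun x => c x u) {L : ℝ} (hL : ∀ x u, |c x u| ≤ L)
    {V : S → ℝ} (hV : Measurable V) {B : ℝ} (hVB : ∀ x, |V x| ≤ B) (ρ : Measure S)
    [IsProbabilityMeasure ρ] (γ : Policy S U) (t : ℕ) :
    ∫ ω, qValue T c β V (ω t).1 (ω t).2 ∂(pathLaw T ρ γ) =
      ∫ ω, c (ω t).1 (ω t).2 ∂(pathLaw T ρ γ) + β * ∫ ω, V (ω (t + 1)).1 ∂(pathLaw T ρ γ) := by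
  have hi : Integrable (fun ω : ℕ → S × U => c (ω t).1 (ω t).2) (pathLaw T ρ γ) :=
    integrable_of_abs_le ((measurable_cost hc).comp (measurable_pi_apply t)) fun ω => hL _ _
  have hVk : Measurable fun z : S × U => ∫ x', V x' ∂(T z) :=
    (StronglyMeasurable.integral_kernel hV.stronglyMeasurable).measurable
  have hi2 : Integrable (fun ω : ℕ → S × U => ∫ x', V x' ∂(T (ω t))) (pathLaw T ρ γ) :=
    integrable_of_abs_le (hVk.comp (measurable_pi_apply t)) fun ω => abs_integral_le_of_abs_le hVB
  rw [integral_succ_fst_pathLaw ρ γ t hV hVB, ← integral_const_mul,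
    ← integral_add hi (hi2.const_mul β)]
  rfl

lemma integrable_qValue_pathLaw [Countable U] [MeasurableSingletonClass U]
    (hβ0 : 0 ≤ β) (hc : ∀ u, Measurable fun x => c x u) {L : ℝ} (hL : ∀ x u, |c x u| ≤ L)
    {V : S → ℝ} (hV : Measurable V) {B : ℝ} (hVB : ∀ x, |V x| ≤ B) (ρ : Measure S)
    [IsProbabilityMeasure ρ] (γ : Policy S U) (t : ℕ) :
    Integrable (fun ω => qValue T c β V (ω t).1 (ω t).2) (pathLaw T ρ γ) := by
  have hm : Measurable fun z : S × U => qValue T c β V z.1 z.2 :=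
    measurable_from_prod_countable_left fun u => measurable_qValue hc hV u
  exact integrable_of_abs_le (hm.comp (measurable_pi_apply t))
    fun ω => abs_qValue_le hβ0 hL hVB _ _

/-- The admissible policy `U_t = f(X_t)`. -/
def stationaryAdmissible (f : S → U) (hf : Measurable f) : AdmissiblePolicy S U where
  init := f
  next _ p := f p.2
  measurable_init := hf
  measurable_next _ := hf.comp measurable_snd

/-- The verification theorem: the solution of the optimality equation is the optimal cost. -/
theorem optimalCost_eq_of_bellman [Finite U] [Nonempty U] [MeasurableSingletonClass U]
    (hc : ∀ u, Measurable fun x => c x u) {L : ℝ} (hL : ∀ x u, |c x u| ≤ L) (hβ0 : 0 < β)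
    (hβ1 : β < 1) {V : S → ℝ} (hV : Measurable V) {B : ℝ} (hVB : ∀ x, |V x| ≤ B)
    (hVeq : ∀ x, V x = ⨅ v, qValue T c β V x v) (x₀ : S) : optimalCost T c β x₀ = V x₀ := by
  have hlow : ∀ γ : AdmissiblePolicy S U, V x₀ ≤ discountedCost T c β x₀ γ := fun γ => by
    -- With V as terminal cost, the n-horizon cost starts at V(x₀) and does not decrease in n, since
    -- V ≤ `qValue` for every action.
    refine ge_of_tendsto' (tendsto_discountedCost hc hL hβ0 hβ1 hVB x₀ γ) fun n => ?_
    induction n with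
    | zero => simp [integral_zero_fst_pathLaw x₀ γ.toPolicy hV]
    | succ n ih =>
      refine ih.trans ?_
      rw [Finset.sum_range_succ, add_assoc, pow_succ, mul_assoc, ← mul_add]
      refine add_le_add le_rfl (mul_le_mul_of_nonneg_left ?_ (pow_nonneg hβ0.le n))
      rw [← integral_qValue_pathLaw hc hL hV hVB]
      refine integral_mono (integrable_of_abs_le
        (hV.comp (measurable_fst.comp (measurable_pi_apply n))) fun ω => hVB _)
        (integrable_qValue_pathLaw hβ0.le hc hL hV hVB _ _ n) fun ω => ?_
      change V (ω n).1 ≤ qValue T c β V (ω n).1 (ω n).2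
      rw [hVeq (ω n).1]
      exact ciInf_le (Set.finite_range _).bddBelow _
  obtain ⟨f, hf, hfV⟩ := exists_measurable_selection
    (fun u => {x | qValue T c β V x u = V x})
    (fun u => measurableSet_eq_fun (measurable_qValue hc hV u) hV) fun x => by
      obtain ⟨u, hu⟩ := exists_eq_ciInf_of_finite (f := fun v => qValue T c β V x v)
      exact ⟨u, hu.trans (hVeq x).symm⟩
  set γ := stationaryAdmissible f hf
  -- Under the minimizing selector the same horizon costs are constant in n, because V equals the
  -- `qValue` of the action taken.
  have hopt : discountedCost T c β x₀ γ = V x₀ := by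
    refine tendsto_nhds_unique (tendsto_discountedCost hc hL hβ0 hβ1 hVB x₀ γ)
      (tendsto_const_nhds.congr fun n => ?_)
    induction n with
    | zero => simp [integral_zero_fst_pathLaw x₀ γ.toPolicy hV]
    | succ n ih =>
      refine ih.trans ?_
      rw [Finset.sum_range_succ, add_assoc, pow_succ, mul_assoc, ← mul_add]
      congr 2
      rw [← integral_qValue_pathLaw hc hL hV hVB]
      obtain ⟨μ, hμ, hlaw⟩ := exists_map_pathLaw_eq_compProd T (Kernel.deterministic f hf)
        (Measure.dirac x₀) n
      have hae : ∀ᵐ z ∂(μ ⊗ₘ Kernel.deterministic f hf), z.2 = f z.1 := by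
        have hms : MeasurableSet {z : S × U | z.2 = f z.1} :=
          measurableSet_eq_fun measurable_snd (hf.comp measurable_fst)
        rw [Measure.ae_compProd_iff hms]
        refine Eventually.of_forall fun x => ?_
        rw [Kernel.deterministic_apply]
        exact (ae_dirac_iff (p := fun u => u = f x) (measurableSet_singleton _)).2 rfl
      rw [← hlaw] at hae
      refine integral_congr_ae ?_
      filter_upwards [ae_of_ae_map (measurable_pi_apply n).aemeasurable hae] with ω hω
      rw [hω]
      exact (hfV _).symm
  refine le_antisymm ?_ ?_
  · exact (ciInf_le ⟨V x₀, by rintro _ ⟨γ, rfl⟩; exact hlow γ⟩ γ).trans hopt.le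
  · have : Nonempty (AdmissiblePolicy S U) := ⟨γ⟩
    exact le_ciInf hlow

end DynamicProgramming

/-! ### Integrals and the total variation norm -/

section TotalVariation

/-- By the Jordan decomposition j of μ - ν, the positive measures μ + j⁻ and ν + j⁺ coincide, so the
difference of the integrals is one against j⁺ minus one against j⁻. As `tvNorm` is the total mass of
j⁺ + j⁻, no further constant appears. -/
lemma abs_integral_sub_le_tvNorm {S : Type*} [MeasurableSpace S] {μ ν : Measure S}
    [IsFiniteMeasure μ] [IsFiniteMeasure ν] {g : S → ℝ} (hg : Measurable g) {B : ℝ}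
    (hB : ∀ x, |g x| ≤ B) : |∫ x, g x ∂μ - ∫ x, g x ∂ν| ≤ B * tvNorm μ ν := by
  set j := (μ.toSignedMeasure - ν.toSignedMeasure).toJordanDecomposition with hj
  have hsum : μ + j.negPart = ν + j.posPart := by
    ext A hA
    have h1 := congrArg (fun s : SignedMeasure S => s A)
      (SignedMeasure.toSignedMeasure_toJordanDecomposition
        (μ.toSignedMeasure - ν.toSignedMeasure))
    simp only [← hj, JordanDecomposition.toSignedMeasure,
      Measure.toSignedMeasure_sub_apply hA] at h1
    rw [← measureReal_eq_measureReal_iff (measure_ne_top _ _) (measure_ne_top _ _),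
      measureReal_add_apply, measureReal_add_apply]
    linarith
  have hi : ∀ (m : Measure S) [IsFiniteMeasure m], Integrable g m := fun m _ =>
    integrable_of_abs_le hg hB
  have h2 : ∫ x, g x ∂μ + ∫ x, g x ∂j.negPart = ∫ x, g x ∂ν + ∫ x, g x ∂j.posPart := by
    rw [← integral_add_measure (hi _) (hi _), ← integral_add_measure (hi _) (hi _), hsum]
  have hb : ∀ (m : Measure S) [IsFiniteMeasure m], |∫ x, g x ∂m| ≤ B * m.real Set.univ :=
    fun m _ => by
      have h := norm_integral_le_of_norm_le_const (μ := m) (f := g) (C := B)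
        (Eventually.of_forall hB)
      rwa [Real.norm_eq_abs] at h
  have htv : tvNorm μ ν = j.posPart.real Set.univ + j.negPart.real Set.univ := by
    rw [tvNorm, SignedMeasure.totalVariation, ← hj, ← measureReal_def, measureReal_add_apply]
  have h3 : ∫ x, g x ∂μ - ∫ x, g x ∂ν = ∫ x, g x ∂j.posPart - ∫ x, g x ∂j.negPart := by linarith
  rw [h3, htv, mul_add]
  exact (abs_sub _ _).trans (add_le_add (hb _) (hb _))

end TotalVariation

/-! ### The optimal `Q`-function of the finite model -/

section FixedPoint

variable {S U : Type*} [MeasurableSpace S] [MeasurableSpace U] {M : ℕ}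
  {T : Kernel (S × U) S} [IsMarkovKernel T] {c : S → U → ℝ} {β : ℝ} {q : S → Fin M}

omit [MeasurableSpace S] [MeasurableSpace U] in
lemma abs_ciInf_quantized_le (Q : Fin M → U → ℝ) :
    ∃ B, ∀ x, |⨅ v, Q (q x) v| ≤ B := by
  obtain ⟨B, hB⟩ := (Set.finite_range fun y => |⨅ v, Q y v|).bddAbove
  exact ⟨B, fun x => hB ⟨q x, rfl⟩⟩

omit [MeasurableSpace U] in
lemma measurable_ciInf_quantized (hq : Measurable q) (Q : Fin M → U → ℝ) :
    Measurable fun x => ⨅ v, Q (q x) v :=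
  (measurable_of_finite fun y => ⨅ v, Q y v).comp hq

/-- The optimality equation of the finite model has a unique solution. -/
theorem exists_unique_isFiniteModelQ [Fintype U] [Nonempty U]
    (hc : ∀ u, Measurable fun x => c x u) (hcb : ∃ L : ℝ, ∀ x u, |c x u| ≤ L) (hβ0 : 0 < β)
    (hβ1 : β < 1) (hq : Measurable q) {π : Measure S} [IsFiniteMeasure π]
    (hπpos : ∀ i, 0 < π (bin q i)) :
    ∃ Qstar : Fin M → U → ℝ, IsFiniteModelQ T c β q π Qstar ∧
      ∀ Q, IsFiniteModelQ T c β q π Q → Q = Qstar := by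
  set Φ : (Fin M → U → ℝ) → Fin M → U → ℝ := fun Q y u =>
    ∫ x, qValue T c β (fun x => ⨅ v, Q (q x) v) x u ∂(binMeasure q π y)
  have hiff : ∀ Q, IsFiniteModelQ T c β q π Q ↔ Function.IsFixedPt Φ Q := fun Q => by
    rw [isFiniteModelQ_iff hc hcb hq hπpos]
    exact ⟨fun h => funext fun y => funext fun u => (h y u).symm,
      fun h y u => (congrFun (congrFun h y) u).symm⟩
  -- The minimum over actions and the averages over kernel and bin do not expand the sup distance;
  -- only the factor β remains.
  have hΦ : ContractingWith ⟨β, hβ0.le⟩ Φ := by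
    refine ⟨hβ1, LipschitzWith.of_dist_le_mul fun Q Q' => ?_⟩
    have hd : 0 ≤ β * dist Q Q' := mul_nonneg hβ0.le dist_nonneg
    refine (dist_pi_le_iff hd).2 fun y => (dist_pi_le_iff hd).2 fun u => ?_
    have hprob := isProbabilityMeasure_binMeasure (hπpos y)
    obtain ⟨L, hL⟩ := hcb
    obtain ⟨B, hB⟩ := abs_ciInf_quantized_le (q := q) Q
    obtain ⟨B', hB'⟩ := abs_ciInf_quantized_le (q := q) Q'
    have hm := measurable_ciInf_quantized hq Q
    have hm' := measurable_ciInf_quantized hq Q'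
    rw [Real.dist_eq, ← integral_sub
      (integrable_of_abs_le (measurable_qValue hc hm u) fun x => abs_qValue_le hβ0.le hL hB x u)
      (integrable_of_abs_le (measurable_qValue hc hm' u) fun x => abs_qValue_le hβ0.le hL hB' x u)]
    exact abs_integral_le_of_abs_le fun x => abs_qValue_sub_le hβ0.le hm hm' hB hB'
      (fun x' => abs_ciInf_sub_ciInf_le fun v =>
        (dist_le_pi_dist (Q (q x')) (Q' (q x')) v).trans (dist_le_pi_dist Q Q' (q x'))) x u
  exact ⟨hΦ.fixedPoint Φ, (hiff _).2 hΦ.fixedPoint_isFixedPt,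
    fun Q hQ => hΦ.fixedPoint_unique ((hiff Q).1 hQ)⟩

/-- At a bin where |min Q| attains its maximum m, the optimality equation gives m ≤ L + βm. The
bound feeds the total variation estimate below. -/
lemma abs_ciInf_finiteModelQ_le [Fintype U] [Nonempty U]
    (hc : ∀ u, Measurable fun x => c x u) {L : ℝ} (hL : ∀ x u, |c x u| ≤ L) (hβ0 : 0 < β)
    (hβ1 : β < 1) (hq : Measurable q) {π : Measure S} [IsFiniteMeasure π]
    (hπpos : ∀ i, 0 < π (bin q i)) {Q : Fin M → U → ℝ} (hQ : IsFiniteModelQ T c β q π Q)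
    (y : Fin M) : |⨅ v, Q y v| ≤ L / (1 - β) := by
  have : Nonempty (Fin M) := ⟨y⟩
  obtain ⟨y₀, hy₀⟩ := Finite.exists_max fun y => |⨅ v, Q y v|
  refine (hy₀ y).trans ?_
  rw [le_div_iff₀ (by linarith)]
  have hprob := isProbabilityMeasure_binMeasure (hπpos y₀)
  have h1 : |⨅ v, Q y₀ v| ≤ L + β * |⨅ v, Q y₀ v| := abs_ciInf_le fun v => by
    rw [(isFiniteModelQ_iff hc ⟨L, hL⟩ hq hπpos Q).1 hQ y₀ v]
    exact abs_integral_le_of_abs_le fun x => abs_qValue_le hβ0.le hL (fun x => hy₀ (q x)) x v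
  linarith

end FixedPoint

/-! ### The error bound -/

section ErrorBound

variable {S U : Type*} [MeasurableSpace S] [MeasurableSpace U] {M : ℕ}
  {T : Kernel (S × U) S} [IsMarkovKernel T] {c : S → U → ℝ} {β : ℝ} {q : S → Fin M}

lemma lintegral_succ_fst_pathLaw (ρ : Measure S) [IsProbabilityMeasure ρ] (f : S → U)
    (hf : Measurable f) (t : ℕ) {g : S → ℝ≥0∞} (hg : Measurable g) :
    ∫⁻ ω, g (ω (t + 1)).1 ∂(pathLaw T ρ (stationaryPolicy (Kernel.deterministic f hf))) =
      ∫⁻ ω, ∫⁻ x', g x' ∂(T ((ω t).1, f (ω t).1))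
        ∂(pathLaw T ρ (stationaryPolicy (Kernel.deterministic f hf))) := by
  set P := pathLaw T ρ (stationaryPolicy (Kernel.deterministic f hf))
  have hm1 : Measurable fun ω : ℕ → S × U => (ω (t + 1)).1 :=
    measurable_fst.comp (measurable_pi_apply _)
  have hG : Measurable fun z : S × U => ∫⁻ x', g x' ∂(T z) := hg.lintegral_kernel
  have hG' : Measurable fun z : S × U => ∫⁻ x', g x' ∂(T (z.1, f z.1)) :=
    hG.comp (measurable_fst.prodMk (hf.comp measurable_fst))
  obtain ⟨μ, hμ, hlaw⟩ := exists_map_pathLaw_eq_compProd T (Kernel.deterministic f hf) ρ t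
  rw [← lintegral_map hg hm1, map_succ_fst_pathLaw, Measure.lintegral_bind T.aemeasurable
    hg.aemeasurable, ← lintegral_map hG' (measurable_pi_apply t), hlaw,
    Measure.lintegral_compProd hG, Measure.lintegral_compProd hG']
  refine lintegral_congr fun x => ?_
  have h1 : Measurable fun u => ∫⁻ x', g x' ∂(T (x, u)) := hG.comp measurable_prodMk_left
  rw [Kernel.deterministic_apply, lintegral_dirac' _ h1]
  dsimp only
  rw [lintegral_const, measure_univ, mul_one]

lemma lintegral_zero_fst_pathLaw (x₀ : S) (γ : Policy S U) {g : S → ℝ≥0∞} (hg : Measurable g) :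
    ∫⁻ ω, g (ω 0).1 ∂(pathLaw T (Measure.dirac x₀) γ) = g x₀ := by
  rw [← lintegral_map (f := fun z : S × U => g z.1) (hg.comp measurable_fst)
    (measurable_pi_apply 0), map_zero_pathLaw, ← lintegral_map hg measurable_fst]
  have h : (Measure.dirac x₀ ⊗ₘ γ.init).map Prod.fst = Measure.dirac x₀ :=
    Measure.fst_compProd _ _
  rw [h, lintegral_dirac' _ hg]

/-- A bounded function which is bounded by a running cost plus its discounted expectation at the
next state is bounded by the total discounted running cost. -/
lemma le_tsum_of_le_step {D ℓ : S → ℝ≥0∞} (hD : Measurable D) (hℓ : Measurable ℓ) {C b : ℝ≥0∞}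
    (hC : C ≠ ∞) (hDC : ∀ x, D x ≤ C) (hb : b < 1) (f : S → U) (hf : Measurable f)
    (hstep : ∀ x, D x ≤ ℓ x + b * ∫⁻ x', D x' ∂(T (x, f x))) (x₀ : S) :
    D x₀ ≤ ∑' t : ℕ, b ^ t * ∫⁻ ω, ℓ (ω t).1
      ∂(pathLaw T (Measure.dirac x₀) (stationaryPolicy (Kernel.deterministic f hf))) := by
  set P := pathLaw T (Measure.dirac x₀) (stationaryPolicy (Kernel.deterministic f hf))
  have hfin : ∀ n : ℕ, D x₀ ≤ (∑ t ∈ Finset.range n, b ^ t * ∫⁻ ω, ℓ (ω t).1 ∂P) +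
      b ^ n * ∫⁻ ω, D (ω n).1 ∂P := fun n => by
    induction n with
    | zero => simp [P, lintegral_zero_fst_pathLaw x₀ _ hD]
    | succ n ih =>
      refine ih.trans ?_
      rw [Finset.sum_range_succ, add_assoc, pow_succ, mul_assoc, ← mul_add]
      gcongr
      have hℓm : Measurable fun ω : ℕ → S × U => ℓ (ω n).1 :=
        hℓ.comp (measurable_fst.comp (measurable_pi_apply n))
      have hDm : Measurable fun x => ∫⁻ x', D x' ∂(T (x, f x)) :=
        (hD.lintegral_kernel (κ := T)).comp (measurable_id.prodMk hf)
      have hDω : Measurable fun ω : ℕ → S × U => ∫⁻ x', D x' ∂(T ((ω n).1, f (ω n).1)) :=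
        hDm.comp (measurable_fst.comp (measurable_pi_apply n))
      rw [lintegral_succ_fst_pathLaw _ f hf n hD, ← lintegral_const_mul _ hDω,
        ← lintegral_add_left hℓm]
      exact lintegral_mono fun ω => hstep _
  -- After n iterations the remainder is at most bⁿC, which vanishes because D is bounded by the
  -- finite constant C.
  have hlim : Tendsto (fun n : ℕ => (∑' t : ℕ, b ^ t * ∫⁻ ω, ℓ (ω t).1 ∂P) + b ^ n * C) atTop
      (𝓝 ((∑' t : ℕ, b ^ t * ∫⁻ ω, ℓ (ω t).1 ∂P) + 0 * C)) :=
    tendsto_const_nhds.add (ENNReal.Tendsto.mul_const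
      (ENNReal.tendsto_pow_atTop_nhds_zero_of_lt_one hb) (Or.inr hC))
  rw [zero_mul, add_zero] at hlim
  refine ge_of_tendsto' hlim fun n => (hfin n).trans ?_
  gcongr
  · exact ENNReal.sum_le_tsum _
  · calc ∫⁻ ω, D (ω n).1 ∂P ≤ ∫⁻ _, C ∂P := lintegral_mono fun ω => hDC _
      _ = C := by simp

lemma lintegral_occupationMeasure (hβ0 : 0 < β) (hβ1 : β < 1) (x₀ : S) (γ : Policy S U)
    {g : S → ℝ≥0∞} (hg : Measurable g) :
    ENNReal.ofReal (1 / (1 - β)) * ∫⁻ x, g x ∂(occupationMeasure T β x₀ γ) =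
      ∑' t : ℕ, ENNReal.ofReal β ^ t * ∫⁻ ω, g (ω t).1 ∂(pathLaw T (Measure.dirac x₀) γ) := by
  have hβ : 0 < 1 - β := by linarith
  rw [occupationMeasure, lintegral_sum_measure, ← ENNReal.tsum_mul_left]
  refine tsum_congr fun t => ?_
  have hm : Measurable fun ω : ℕ → S × U => (ω t).1 := measurable_fst.comp (measurable_pi_apply t)
  rw [lintegral_smul_measure, lintegral_map hg hm, smul_eq_mul, ← mul_assoc,
    ← ENNReal.ofReal_mul (by positivity), ← ENNReal.ofReal_pow hβ0.le]
  congr 2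
  field_simp

instance (x₀ : S) (γ : Policy S U) : SFinite (occupationMeasure T β x₀ γ) := by
  have : ∀ t : ℕ, SFinite (ENNReal.ofReal ((1 - β) * β ^ t) •
      (pathLaw T (Measure.dirac x₀) γ).map (fun ω => (ω t).1)) := fun t => by
    have : IsFiniteMeasure (ENNReal.ofReal ((1 - β) * β ^ t) •
      (pathLaw T (Measure.dirac x₀) γ).map (fun ω => (ω t).1)) :=
      Measure.smul_finite _ ENNReal.ofReal_ne_top
    infer_instance
  unfold occupationMeasure
  infer_instance

/-- The average distance of `x` to the points of its bin. -/
noncomputable def binRadius (d : S → S → ℝ) (q : S → Fin M) (π : Measure S) (x : S) : ℝ≥0∞ :=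
  ∫⁻ x', ENNReal.ofReal (d x x') ∂(binMeasure q π (q x))

lemma binRadius_eq_sum (d : S → S → ℝ) (π : Measure S) (x : S) :
    binRadius d q π x = ∑ i, (bin q i).indicator
      (fun x => ∫⁻ x', ENNReal.ofReal (d x x') ∂(binMeasure q π i)) x := by
  classical
  simp [binRadius, bin, Set.indicator_apply]

instance (π : Measure S) [IsFiniteMeasure π] (i : Fin M) : IsFiniteMeasure (binMeasure q π i) := by
  unfold binMeasure; infer_instance

lemma measurable_binRadius_aux {d : S → S → ℝ} (hd : Measurable fun p : S × S => d p.1 p.2)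
    (π : Measure S) [IsFiniteMeasure π] (i : Fin M) :
    Measurable fun x => ∫⁻ x', ENNReal.ofReal (d x x') ∂(binMeasure q π i) :=
  hd.ennreal_ofReal.lintegral_prod_right'

lemma measurable_binRadius (hq : Measurable q) {d : S → S → ℝ}
    (hd : Measurable fun p : S × S => d p.1 p.2) (π : Measure S) [IsFiniteMeasure π] :
    Measurable (binRadius d q π) := by
  have h : binRadius d q π = fun x => ∑ i, (bin q i).indicator
      (fun x => ∫⁻ x', ENNReal.ofReal (d x x') ∂(binMeasure q π i)) x :=
    funext fun x => binRadius_eq_sum d π x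
  rw [h]
  exact Finset.measurable_sum _ fun i _ =>
    (measurable_binRadius_aux hd π i).indicator (measurableSet_bin hq i)

/-- Tonelli's theorem exchanges the two integrals on each bin; this is where s-finiteness of the
occupation measure is used. -/
lemma lintegral_binRadius (hq : Measurable q) {d : S → S → ℝ}
    (hd : Measurable fun p : S × S => d p.1 p.2) (π : Measure S) [IsFiniteMeasure π]
    (μ : Measure S) [SFinite μ] :
    ∫⁻ x, binRadius d q π x ∂μ = ∑ i, ∫⁻ x' in bin q i, ∫⁻ x in bin q i,
      ENNReal.ofReal (d x x') ∂μ ∂(binMeasure q π i) := by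
  simp_rw [binRadius_eq_sum]
  rw [lintegral_finsetSum _ fun i _ =>
    (measurable_binRadius_aux hd π i).indicator (measurableSet_bin hq i)]
  refine Finset.sum_congr rfl fun i _ => ?_
  have hres : (binMeasure q π i).restrict (bin q i) = binMeasure q π i :=
    Measure.restrict_eq_self_of_ae_mem (ae_cond_mem (measurableSet_bin hq i))
  rw [lintegral_indicator (measurableSet_bin hq i), hres]
  exact lintegral_lintegral_swap hd.ennreal_ofReal.aemeasurable

variable [Fintype U] [Nonempty U]

/-- Q(q(x),u) is the average of the `qValue` of W over the points x' of the bin of x, so it suffices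
to compare the decision problem at x with that at each x' and to integrate over x'. -/
lemma ofReal_abs_finiteModelQ_sub_le
    (hc : ∀ u, Measurable fun x => c x u) {L : ℝ} (hL : ∀ x u, |c x u| ≤ L) (hβ0 : 0 < β)
    (hβ1 : β < 1) {αc αT : ℝ} {d : S → S → ℝ} (hd : Measurable fun p : S × S => d p.1 p.2)
    (hcLip : ∀ x x' u, |c x u - c x' u| ≤ αc * d x x')
    (hTLip : ∀ x x' u, tvNorm (T (x, u)) (T (x', u)) ≤ αT * d x x') (hq : Measurable q)
    (hα : 0 ≤ αc + β * αT * L / (1 - β))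
    {π : Measure S} [IsFiniteMeasure π] (hπpos : ∀ i, 0 < π (bin q i)) {Q : Fin M → U → ℝ}
    (hQ : IsFiniteModelQ T c β q π Q) {V : S → ℝ} (hV : Measurable V) {B : ℝ}
    (hVB : ∀ x, |V x| ≤ B) (x : S) (u : U) :
    ENNReal.ofReal |qValue T c β V x u - Q (q x) u| ≤
      ENNReal.ofReal (αc + β * αT * L / (1 - β)) * binRadius d q π x +
      ENNReal.ofReal β * ∫⁻ x', ENNReal.ofReal |V x' - ⨅ v, Q (q x') v| ∂(T (x, u)) := by
  set W : S → ℝ := fun x => ⨅ v, Q (q x) v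
  have hW : Measurable W := measurable_ciInf_quantized hq Q
  have hWB : ∀ x, |W x| ≤ L / (1 - β) := fun x =>
    abs_ciInf_finiteModelQ_le hc hL hβ0 hβ1 hq hπpos hQ (q x)
  have hprob := isProbabilityMeasure_binMeasure (hπpos (q x))
  set κ := αc + β * αT * L / (1 - β)
  set E := ∫ x', |V x' - W x'| ∂(T (x, u))
  have hE0 : 0 ≤ E := integral_nonneg fun x' => abs_nonneg _
  have hVW : Integrable (fun x' => V x' - W x') (T (x, u)) :=
    (integrable_of_abs_le hV hVB).sub (integrable_of_abs_le hW hWB)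
  have hE : ENNReal.ofReal E = ∫⁻ x', ENNReal.ofReal |V x' - W x'| ∂(T (x, u)) :=
    ofReal_integral_eq_lintegral_ofReal hVW.abs (Eventually.of_forall fun x' => abs_nonneg _)
  -- It is W, bounded by L/(1-β), that is carried from T(x,u) to T(x',u); this produces the second
  -- term of κ. The difference V - W is integrated under T(x,u) only, so E does not depend on x'.
  have hpt : ∀ x', |qValue T c β V x u - qValue T c β W x' u| ≤ κ * d x x' + β * E := fun x' => by
    have h1 : qValue T c β V x u - qValue T c β W x' u =
        (c x u - c x' u) + β * (∫ y, W y ∂(T (x, u)) - ∫ y, W y ∂(T (x', u))) +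
          β * ∫ y, (V y - W y) ∂(T (x, u)) := by
      rw [integral_sub (integrable_of_abs_le hV hVB) (integrable_of_abs_le hW hWB)]
      simp only [qValue]
      ring
    have hL0 : 0 ≤ L / (1 - β) := (abs_nonneg _).trans (hWB x)
    have h2 : |∫ y, W y ∂(T (x, u)) - ∫ y, W y ∂(T (x', u))| ≤ L / (1 - β) * (αT * d x x') :=
      (abs_integral_sub_le_tvNorm hW hWB).trans (mul_le_mul_of_nonneg_left (hTLip x x' u) hL0)
    have h3 : |∫ y, (V y - W y) ∂(T (x, u))| ≤ E := abs_integral_le_integral_abs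
    rw [h1]
    calc _ ≤ |c x u - c x' u| + |β * (∫ y, W y ∂(T (x, u)) - ∫ y, W y ∂(T (x', u)))| +
          |β * ∫ y, (V y - W y) ∂(T (x, u))| := abs_add_three _ _ _
      _ ≤ αc * d x x' + β * (L / (1 - β) * (αT * d x x')) + β * E := by
        rw [abs_mul, abs_mul, abs_of_pos hβ0]
        gcongr
        exact hcLip x x' u
      _ = κ * d x x' + β * E := by ring
  have hqi : Integrable (fun x' => qValue T c β W x' u) (binMeasure q π (q x)) :=
    integrable_of_abs_le (measurable_qValue hc hW u) fun x' => abs_qValue_le hβ0.le hL hWB x' u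
  have hdiff : qValue T c β V x u - Q (q x) u =
      ∫ x', (qValue T c β V x u - qValue T c β W x' u) ∂(binMeasure q π (q x)) := by
    rw [integral_sub (integrable_const _) hqi,
      (isFiniteModelQ_iff hc ⟨L, hL⟩ hq hπpos Q).1 hQ (q x) u]
    simp [W]
  rw [hdiff, ← Real.enorm_eq_ofReal_abs, ← hE]
  refine (enorm_integral_le_lintegral_enorm _).trans ?_
  have hdx : Measurable fun x' => ENNReal.ofReal (d x x') :=
    hd.ennreal_ofReal.comp measurable_prodMk_left
  calc ∫⁻ x', ‖qValue T c β V x u - qValue T c β W x' u‖ₑ ∂(binMeasure q π (q x))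
      ≤ ∫⁻ x', (ENNReal.ofReal κ * ENNReal.ofReal (d x x') + ENNReal.ofReal β * ENNReal.ofReal E)
          ∂(binMeasure q π (q x)) := by
        refine lintegral_mono fun x' => ?_
        rw [Real.enorm_eq_ofReal_abs]
        refine (ENNReal.ofReal_le_ofReal (hpt x')).trans (ENNReal.ofReal_add_le.trans ?_)
        rw [ENNReal.ofReal_mul hα, ENNReal.ofReal_mul hβ0.le]
    _ = ENNReal.ofReal κ * binRadius d q π x + ENNReal.ofReal β * ENNReal.ofReal E := by
        rw [lintegral_add_right _ measurable_const, lintegral_const_mul _ hdx, lintegral_const,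
          measure_univ, mul_one, binRadius]

/-- The loss of the quantized value function is bounded by the total discounted average distance
to the points of the current bin, under some deterministic stationary policy. -/
theorem optimalCost_sub_finiteModel_le [MeasurableSingletonClass U]
    (hc : ∀ u, Measurable fun x => c x u) {L : ℝ} (hL : ∀ x u, |c x u| ≤ L) (hβ0 : 0 < β)
    (hβ1 : β < 1) {αc αT : ℝ} {d : S → S → ℝ} (hd : Measurable fun p : S × S => d p.1 p.2)
    (hcLip : ∀ x x' u, |c x u - c x' u| ≤ αc * d x x')
    (hTLip : ∀ x x' u, tvNorm (T (x, u)) (T (x', u)) ≤ αT * d x x') (hq : Measurable q)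
    (hα : 0 ≤ αc + β * αT * L / (1 - β))
    {π : Measure S} [IsFiniteMeasure π] (hπpos : ∀ i, 0 < π (bin q i)) {Q : Fin M → U → ℝ}
    (hQ : IsFiniteModelQ T c β q π Q) (x₀ : S) :
    ENNReal.ofReal |optimalCost T c β x₀ - ⨅ v, Q (q x₀) v| ≤
      ENNReal.ofReal (αc + β * αT * L / (1 - β)) *
        ⨆ γ : {f : S → U // Measurable f},
          ENNReal.ofReal (1 / (1 - β)) *
            ∑ i, ∫⁻ x' in bin q i, ∫⁻ x in bin q i, ENNReal.ofReal (d x x')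
              ∂(occupationMeasure T β x₀ (stationaryPolicy (Kernel.deterministic γ.1 γ.2)))
              ∂(binMeasure q π i) := by
  obtain ⟨V, hV, ⟨B, hVB⟩, hVeq⟩ := exists_bellman_solution (T := T) hc hL hβ0 hβ1
  rw [optimalCost_eq_of_bellman hc hL hβ0 hβ1 hV hVB hVeq x₀]
  set κ := αc + β * αT * L / (1 - β)
  have hW : Measurable fun x => ⨅ v, Q (q x) v := measurable_ciInf_quantized hq Q
  obtain ⟨B', hWB⟩ := abs_ciInf_quantized_le (q := q) Q
  set D : S → ℝ≥0∞ := fun x => ENNReal.ofReal |V x - ⨅ v, Q (q x) v|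
  have hD : Measurable D := (continuous_abs.measurable.comp (hV.sub hW)).ennreal_ofReal
  have hDC : ∀ x, D x ≤ ENNReal.ofReal (B + B') := fun x =>
    ENNReal.ofReal_le_ofReal ((abs_sub _ _).trans (add_le_add (hVB x) (hWB x)))
  have hTD : ∀ u, Measurable fun x => ∫⁻ x', D x' ∂(T (x, u)) := fun u =>
    (hD.lintegral_kernel (κ := T)).comp measurable_prodMk_right
  -- f maximizes the expected error at the next state, so one stationary policy dominates the
  -- recursion whichever action realizes the present error.
  obtain ⟨f, hf, hfmax⟩ := exists_measurable_selection
    (fun u => {x | ∀ v, ∫⁻ x', D x' ∂(T (x, v)) ≤ ∫⁻ x', D x' ∂(T (x, u))})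
    (fun u => by
      rw [Set.ofPred_forall]
      exact MeasurableSet.iInter fun v => measurableSet_le (hTD v) (hTD u))
    fun x => Finite.exists_max fun v => ∫⁻ x', D x' ∂(T (x, v))
  have hstep : ∀ x, D x ≤ ENNReal.ofReal κ * binRadius d q π x +
      ENNReal.ofReal β * ∫⁻ x', D x' ∂(T (x, f x)) := fun x => by
    obtain ⟨u, hu⟩ := Finite.exists_max fun v => |qValue T c β V x v - Q (q x) v|
    have h1 : |V x - ⨅ v, Q (q x) v| ≤ |qValue T c β V x u - Q (q x) u| := by
      rw [hVeq x]; exact abs_ciInf_sub_ciInf_le hu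
    refine (ENNReal.ofReal_le_ofReal h1).trans ((ofReal_abs_finiteModelQ_sub_le hc hL hβ0 hβ1 hd
      hcLip hTLip hq hα hπpos hQ hV hVB x u).trans ?_)
    exact add_le_add le_rfl (mul_le_mul' le_rfl (hfmax x u))
  have hℓ := measurable_binRadius hq hd π
  refine (le_tsum_of_le_step hD (hℓ.const_mul _) ENNReal.ofReal_ne_top hDC
    (ENNReal.ofReal_lt_one.2 hβ1) f hf hstep x₀).trans ?_
  rw [← lintegral_occupationMeasure hβ0 hβ1 x₀ _ (hℓ.const_mul _), lintegral_const_mul _ hℓ,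
    lintegral_binRadius hq hd π, mul_left_comm]
  gcongr
  exact le_iSup (fun γ : {f : S → U // Measurable f} => ENNReal.ofReal (1 / (1 - β)) *
    ∑ i, ∫⁻ x' in bin q i, ∫⁻ x in bin q i, ENNReal.ofReal (d x x')
      ∂(occupationMeasure T β x₀ (stationaryPolicy (Kernel.deterministic γ.1 γ.2)))
      ∂(binMeasure q π i)) ⟨f, hf⟩

end ErrorBound

/-! ### The ℓ¹ distance and the final assembly -/

lemma continuous_l1Dist {n : ℕ} :
    Continuous fun p : (Fin n → ℝ) × (Fin n → ℝ) => l1Dist p.1 p.2 := by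
  unfold l1Dist
  fun_prop

/-- Measurability of the cost in the state is not assumed in the main theorem; it follows from the
Lipschitz condition through this continuity. -/
lemma continuous_of_l1Dist_le {n : ℕ} {X : Set (Fin n → ℝ)} {g : X → ℝ} {α : ℝ}
    (h : ∀ x x' : X, |g x - g x'| ≤ α * l1Dist (x : Fin n → ℝ) x') : Continuous g := by
  refine continuous_iff_continuousAt.2 fun x => ?_
  refine tendsto_iff_norm_sub_tendsto_zero.2
    (squeeze_zero (fun _ => norm_nonneg _) (fun x' => h x' x) ?_)
  have h1 : Continuous fun x' : X => α * l1Dist (x' : Fin n → ℝ) x :=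
    continuous_const.mul (continuous_l1Dist.comp (continuous_subtype_val.prodMk continuous_const))
  have h2 := h1.tendsto x
  have h3 : l1Dist (x : Fin n → ℝ) x = 0 := by simp [l1Dist]
  rwa [h3, mul_zero] at h2

lemma abs_le_supNorm {S U : Type*} {c : S → U → ℝ} (hc : ∃ K : ℝ, ∀ x u, |c x u| ≤ K) (x : S)
    (u : U) : |c x u| ≤ supNorm c := by
  obtain ⟨K, hK⟩ := hc
  exact le_ciSup (f := fun p : S × U => |c p.1 p.2|)
    ⟨K, by rintro _ ⟨p, rfl⟩; exact hK p.1 p.2⟩ (x, u)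

end QuantizedMDP

theorem mainTheorem7 {n M : ℕ} (X : Set (Fin n → ℝ)) (hX : MeasurableSet X)
    {U : Type*} [Fintype U] [Nonempty U] [MeasurableSpace U] [MeasurableSingletonClass U]
    (T : Kernel (X × U) X) [IsMarkovKernel T]
    (c : X → U → ℝ) (hc : ∃ K : ℝ, ∀ x u, |c x u| ≤ K)
    (β : ℝ) (hβ0 : 0 < β) (hβ1 : β < 1)
    (αc αT : ℝ) (hαc : 0 < αc) (hαT : 0 < αT)
    (hcLip : ∀ (x x' : X) (u : U),
      |c x u - c x' u| ≤ αc * QuantizedMDP.l1Dist (x : Fin n → ℝ) x')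
    (hTLip : ∀ (x x' : X) (u : U),
      QuantizedMDP.tvNorm (T (x, u)) (T (x', u)) ≤
        αT * QuantizedMDP.l1Dist (x : Fin n → ℝ) x')
    (q : X → Fin M) (hq : Measurable q)
    (η : Kernel X U) [IsMarkovKernel η] (π : Measure X)
    (hπ : QuantizedMDP.IsUniqueInvariant (QuantizedMDP.stateKernel T η) π)
    (hπpos : ∀ i, 0 < π (QuantizedMDP.bin q i)) :
    ∃ Qstar : Fin M → U → ℝ,
      -- `Qstar` is the `Q`-function of the finite model weighted by `π`
      QuantizedMDP.IsFiniteModelQ T c β q π Qstar ∧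
      (∀ Q, QuantizedMDP.IsFiniteModelQ T c β q π Q → Q = Qstar) ∧
      -- `Qstar` is the almost sure limit of quantized Q-learning
      (∀ (ρ : Measure X), IsProbabilityMeasure ρ →
        (∀ x x', q x = q x' → η x = η x') →
        (∀ A : Set X, MeasurableSet A → π A = 1 →
          ∀ᵐ ω ∂(QuantizedMDP.pathLaw T ρ (QuantizedMDP.stationaryPolicy η)),
            ∃ t, (ω t).1 ∈ A) →
        (∀ᵐ ω ∂(QuantizedMDP.pathLaw T ρ (QuantizedMDP.stationaryPolicy η)),
          ∀ y u, ∃ᶠ t in atTop, q (ω t).1 = y ∧ (ω t).2 = u) →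
        ∀ Q₀ : Fin M → U → ℝ,
          ∀ᵐ ω ∂(QuantizedMDP.pathLaw T ρ (QuantizedMDP.stationaryPolicy η)),
            ∀ y u, Tendsto (fun t => QuantizedMDP.qLearning c β q Q₀ ω t y u) atTop
              (𝓝 (Qstar y u))) ∧
      -- the error bound, for every initial state (the right-hand side may be infinite)
      ∀ x₀ : X,
        ENNReal.ofReal |QuantizedMDP.optimalCost T c β x₀ - ⨅ v, Qstar (q x₀) v| ≤
          ENNReal.ofReal (αc + β * αT * QuantizedMDP.supNorm c / (1 - β)) *
            ⨆ γ : {f : X → U // Measurable f},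
              ENNReal.ofReal (1 / (1 - β)) *
                ∑ i, ∫⁻ x' in QuantizedMDP.bin q i, ∫⁻ x in QuantizedMDP.bin q i,
                  ENNReal.ofReal (QuantizedMDP.l1Dist (x : Fin n → ℝ) x')
                  ∂(QuantizedMDP.occupationMeasure T β x₀
                    (QuantizedMDP.stationaryPolicy (Kernel.deterministic γ.1 γ.2)))
                  ∂(QuantizedMDP.binMeasure q π i) := by

  have hprob := hπ.1
  have hcm : ∀ u, Measurable fun x => c x u := fun u =>
    (QuantizedMDP.continuous_of_l1Dist_le fun x x' => hcLip x x' u).measurable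
  have hd : Measurable fun p : X × X => QuantizedMDP.l1Dist (p.1 : Fin n → ℝ) p.2 :=
    (QuantizedMDP.continuous_l1Dist.comp ((continuous_subtype_val.comp continuous_fst).prodMk
      (continuous_subtype_val.comp continuous_snd))).measurable
  obtain ⟨Qstar, hQ, huniq⟩ := QuantizedMDP.exists_unique_isFiniteModelQ (T := T) hcm hc hβ0 hβ1 hq
    hπpos
  refine ⟨Qstar, hQ, huniq, fun ρ hρ hη hhit hio Q₀ =>
    QuantizedMDP.ae_tendsto_qLearning hcm hc hβ0 hβ1 hq hπ hπpos hQ hη hhit hio Q₀, fun x₀ => ?_⟩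
  refine QuantizedMDP.optimalCost_sub_finiteModel_le hcm (QuantizedMDP.abs_le_supNorm hc) hβ0 hβ1 hd
    hcLip hTLip hq ?_ hπpos hQ x₀
  have hβ : 0 < 1 - β := by linarith
  have hL : 0 ≤ QuantizedMDP.supNorm c := Real.iSup_nonneg fun p => abs_nonneg _
  positivity
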